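/- Let $M\in\mathbb{C}^{n\times n}$ be a (not necessarily Hermitian) positive-definite matrix, i.e. $\operatorname{Re}(x^*Mx)>0$ for every unit vector $x\in\mathbb{C}^n$, let $b\in\mathbb{C}^n$, and let $k\ge 2$ be an integer. For a square matrix $A$ and a function $f$ analytic on and inside a circle $\mathcal C$ enclosing the spectrum of $A$, put $f(A)=-\frac{1}{2\pi i}\oint_{\mathcal C} f(z)(A-zI)^{-1}\,dz$, and take $f(z)=z^{1/2}$, the principal branch. Run the Arnoldi process on $(M,b)$ with iteration number $k$: $q_1=b/\|b\|$; for $j=1,2,\dots,k$ set $w=Mq_j$; for $i=1,\dots,j$ set $h_{i,j}=q_i^*w$ and replace $w$ by $w-h_{i,j}q_i$; then put $h_{j+1,j}=\|w\|$, stop if $h_{j+1,j}=0$, and otherwise put $q_{j+1}=w/h_{j+1,j}$. Let $m\le k$ be the number of steps $j$ carried out ($m=k$ unless the process stops earlier), let $Q_k=[q_1,\dots,q_m]$, and let $H_k=[h_{i,j}]_{1\le i,j\le m}$, with $h_{i,j}=0$ for $i>j+1$. Put $$\operatorname{Arn}_k(f;M,b)=Q_k f(H_k) Q_k^* b,\qquad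 \xi_0^k=M^{-1}b-Q_kH_k^{-1}\|b\|e_1 .$$ (For $b=0$ the process is read as giving $q_1=0$, and then $\operatorname{Arn}_k(f;M,b)=\xi_0^k=0$.) Then $M^{1/2}:=f(M)$ is the unique positive-definite matrix whose square is $M$, and $$\left\|M^{1/2}b-\operatorname{Arn}_k(f;M,b)\right\|\le \frac{\Gamma(3/4)}{2^{1/4}\pi}\,\frac{2k}{2k-3}\,\bigl(\sigma_{\max}(M)\bigr)^{3/2}\,k^{-3/4}\,\left\|\xi_0^k\right\|,$$ where $\|\cdot\|$ is the Euclidean norm, $\Gamma$ is the Gamma function and $\sigma_{\max}(M)$ is the largest singular value of $M$. -/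

import Mathlib

open scoped Real

noncomputable section

/-- A complex matrix `M`, not necessarily Hermitian, is positive definite when
`Re (x^* M x) > 0` for every unit vector `x`. -/
def IsPosDef {n : ℕ} (M : Matrix (Fin n) (Fin n) ℂ) : Prop :=
  ∀ x : EuclideanSpace ℂ (Fin n), ‖x‖ = 1 → 0 < (inner ℂ x (Matrix.toEuclideanLin M x)).re

/-- The largest singular value (Mathlib lists the singular values in decreasing order). -/
def sigmaMax {n : ℕ} (M : Matrix (Fin n) (Fin n) ℂ) : ℝ :=
  (Matrix.toEuclideanLin M).singularValues 0

/-- The circle of centre `c` and radius `r` is an admissible contour for `f(A)`: it encloses the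
spectrum of `A`, and `f` is analytic on and inside it. -/
def IsAdmissibleCircle {n : ℕ} (f : ℂ → ℂ) (A : Matrix (Fin n) (Fin n) ℂ) (c : ℂ) (r : ℝ) : Prop :=
  0 < r ∧ spectrum ℂ A ⊆ Metric.ball c r ∧ AnalyticOnNhd ℂ f (Metric.closedBall c r)

/-- `-(2πi)⁻¹ ∮ f(z) (A - zI)⁻¹ dz` over the circle of centre `c` and radius `r`
(counterclockwise), entry by entry. -/
def cauchyIntegral {n : ℕ} (f : ℂ → ℂ) (A : Matrix (Fin n) (Fin n) ℂ) (c : ℂ) (r : ℝ) :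
    Matrix (Fin n) (Fin n) ℂ :=
  Matrix.of fun i j =>
    -(1 / (2 * (π : ℂ) * Complex.I)) *
      ∮ z in C(c, r), f z * (A - z • (1 : Matrix (Fin n) (Fin n) ℂ))⁻¹ i j

open Classical in
/-- The matrix function `f(A)`, by the Cauchy integral formula over an admissible circle.  The value
does not depend on the circle; it is set to `0` when there is no admissible circle.  (A spectrum in
the open right half-plane has an admissible circle for every `f` that is analytic there.) -/
def matrixFun {n : ℕ} (f : ℂ → ℂ) (A : Matrix (Fin n) (Fin n) ℂ) : Matrix (Fin n) (Fin n) ℂ :=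
  if h : ∃ p : ℂ × ℝ, IsAdmissibleCircle f A p.1 p.2 then
    cauchyIntegral f A h.choose.1 h.choose.2
  else 0

/-- The principal branch of `z ↦ z^{1/2}`. -/
def principalSqrt (z : ℂ) : ℂ := z ^ (1 / 2 : ℂ)

/-- The inner loop of the Arnoldi process: for `i = 0, …, m - 1` in turn, replace `w` by
`w - (q_i^* w) q_i`. -/
def orthSweep {n : ℕ} : (m : ℕ) → (Fin m → EuclideanSpace ℂ (Fin n)) →
    EuclideanSpace ℂ (Fin n) → EuclideanSpace ℂ (Fin n)
  | 0, _, w => w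
  | m + 1, q, w =>
    let v := orthSweep m (fun i => q i.castSucc) w
    v - inner ℂ (q (Fin.last m)) v • q (Fin.last m)

/-- The Arnoldi vectors, numbered from `0`: `q_0 = b / ‖b‖` and `q_{j+1} = w / ‖w‖`, where `w` is
`M q_j` after the inner loop over `q_0, …, q_j`. -/
def arnoldiVec {n : ℕ} (M : Matrix (Fin n) (Fin n) ℂ) (b : EuclideanSpace ℂ (Fin n)) :
    ℕ → EuclideanSpace ℂ (Fin n)
  | 0 => ((‖b‖⁻¹ : ℝ) : ℂ) • b
  | j + 1 =>
    let w := orthSweep (j + 1) (fun i : Fin (j + 1) => arnoldiVec M b i.val)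
      (Matrix.toEuclideanLin M (arnoldiVec M b j))
    ((‖w‖⁻¹ : ℝ) : ℂ) • w
  termination_by j => j
  decreasing_by all_goals omega

/-- The vector `w` in column `j` of the Arnoldi process, after `i` turns of the inner loop. -/
def arnoldiW {n : ℕ} (M : Matrix (Fin n) (Fin n) ℂ) (b : EuclideanSpace ℂ (Fin n)) (i j : ℕ) :
    EuclideanSpace ℂ (Fin n) :=
  orthSweep i (fun l : Fin i => arnoldiVec M b l.val) (Matrix.toEuclideanLin M (arnoldiVec M b j))

/-- The subdiagonal number `h_{j+1,j} = ‖w‖`, with `w` taken at the end of the inner loop. -/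
def arnoldiSubdiag {n : ℕ} (M : Matrix (Fin n) (Fin n) ℂ) (b : EuclideanSpace ℂ (Fin n)) (j : ℕ) :
    ℝ :=
  ‖arnoldiW M b (j + 1) j‖

open Classical in
/-- The number of steps that the Arnoldi process with iteration number `k` carries out: step `j` is
reached when no earlier step has stopped the process by `h_{i+1,i} = 0`.  It equals `k` unless the
process breaks down before step `k`. -/
def arnoldiDim {n : ℕ} (M : Matrix (Fin n) (Fin n) ℂ) (b : EuclideanSpace ℂ (Fin n)) (k : ℕ) : ℕ :=
  ((Finset.range k).filter fun j => ∀ i < j, arnoldiSubdiag M b i ≠ 0).card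

/-- The matrix `Q_k` of the Arnoldi process. -/
def arnoldiQ {n : ℕ} (M : Matrix (Fin n) (Fin n) ℂ) (b : EuclideanSpace ℂ (Fin n)) (k : ℕ) :
    Matrix (Fin n) (Fin (arnoldiDim M b k)) ℂ :=
  Matrix.of fun i j => arnoldiVec M b j.val i

/-- The upper Hessenberg matrix `H_k` of the Arnoldi process. -/
def arnoldiH {n : ℕ} (M : Matrix (Fin n) (Fin n) ℂ) (b : EuclideanSpace ℂ (Fin n)) (k : ℕ) :
    Matrix (Fin (arnoldiDim M b k)) (Fin (arnoldiDim M b k)) ℂ :=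
  Matrix.of fun i j =>
    if i.val ≤ j.val then inner ℂ (arnoldiVec M b i.val) (arnoldiW M b i.val j.val)
    else if i.val = j.val + 1 then (arnoldiSubdiag M b j.val : ℂ)
    else 0

/-- The Arnoldi approximation `Arn_k(f; M, b) = Q_k f(H_k) Q_k^* b` of `f(M) b`. -/
def arnoldiApprox {n : ℕ} (f : ℂ → ℂ) (M : Matrix (Fin n) (Fin n) ℂ)
    (b : EuclideanSpace ℂ (Fin n)) (k : ℕ) : EuclideanSpace ℂ (Fin n) :=
  Matrix.toEuclideanLin
    (arnoldiQ M b k * matrixFun f (arnoldiH M b k) * (arnoldiQ M b k).conjTranspose) b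

/-- The error `ξ_z^k = (M - zI)⁻¹ b - Q_k (H_k - zI)⁻¹ ‖b‖ e_1` of the full orthogonalization method
for the shifted system `(M - zI) x = b`. -/
def fomError {n : ℕ} (M : Matrix (Fin n) (Fin n) ℂ) (b : EuclideanSpace ℂ (Fin n)) (k : ℕ) (z : ℂ) :
    EuclideanSpace ℂ (Fin n) :=
  Matrix.toEuclideanLin (M - z • (1 : Matrix (Fin n) (Fin n) ℂ))⁻¹ b -
    Matrix.toEuclideanLin (arnoldiQ M b k * (arnoldiH M b k - z • 1)⁻¹)
      (WithLp.toLp 2 fun i => if i.val = 0 then (‖b‖ : ℂ) else 0)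

end

/-! ### Functional calculus by Cauchy integrals over a circle. -/

noncomputable section

open Matrix Polynomial

variable {n : ℕ} {A : Matrix (Fin n) (Fin n) ℂ} {c : ℂ} {r : ℝ} {f g : ℂ → ℂ}

/-! The error is an integral of errors of shifted linear systems, and every shifted error is an
explicit transform of the unshifted one.

If the spectrum of `A` lies in the open right half-plane, then `A^{1/2} = π⁻¹ ∫₀^∞ t^{-1/2} A (A +
t)⁻¹ dt`. Apply this to `M` and to `H`, which is the compression `Q* M Q` and so again positive
definite. Since `A (A + t)⁻¹ = 1 - t (A + t)⁻¹` and `Q ‖b‖ e₁ = b`, the identity terms cancel and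
the error equals `-π⁻¹ ∫ √t ξ_{-t} dt` (`IsPosDef.inner_error_eq`).

By the Arnoldi relation the residual of `ξ_z` is a multiple of the next Arnoldi vector. After
multiplication by `det (H - z)`, its coefficient involves `z` only through a corner entry of `adj (H
- z)`, which for a Hessenberg matrix is a signed product of subdiagonal entries, untouched by the
shift (`det_smul_sub_fomError`). Hence `ξ_{-t} = (det H / det (H + t)) M (M + t)⁻¹ ξ_0`. With `a =
√(1 + (t/σ)²)`, each of the `k` eigenvalues of `H` contributes a factor at most `1/a`, and so does
`M (M + t)⁻¹`; thus `‖ξ_{-t}‖ ≤ a^{-(k+1)} ‖ξ_0‖` (`IsPosDef.sqrt_pow_mul_norm_fomError_le`). After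
an early stop the shifted error is zero. The remaining scalar integral is compared with a Gamma
integral.

The claims on `M^{1/2}` rest on the functional calculus: it is multiplicative, its values are
polynomials in the matrix, and the integral representation yields positivity. -/

theorem isUnit_sub_smul_one {z : ℂ} (hz : z ∉ spectrum ℂ A) :
    IsUnit (A - z • (1 : Matrix (Fin n) (Fin n) ℂ)) := by
  have h := spectrum.notMem_iff.mp hz
  rw [Algebra.algebraMap_eq_smul_one] at h
  simpa using h.neg

theorem isUnit_det_sub_smul_one {z : ℂ} (hz : z ∉ spectrum ℂ A) :
    IsUnit (A - z • (1 : Matrix (Fin n) (Fin n) ℂ)).det :=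
  (Matrix.isUnit_iff_isUnit_det _).mp (isUnit_sub_smul_one hz)

theorem continuousAt_functional_resolvent (φ : Matrix (Fin n) (Fin n) ℂ →ₗ[ℂ] ℂ) {z : ℂ}
    (hz : z ∉ spectrum ℂ A) : ContinuousAt (fun z : ℂ => φ (A - z • 1)⁻¹) z := by
  have hφ : Continuous φ := φ.continuous_of_finiteDimensional
  have h1 : Continuous fun z : ℂ => A - z • (1 : Matrix (Fin n) (Fin n) ℂ) := by fun_prop
  have h : (fun z : ℂ => φ (A - z • 1)⁻¹) =
      fun z => (A - z • (1 : Matrix (Fin n) (Fin n) ℂ)).det⁻¹ * φ (A - z • 1).adjugate := by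
    funext z
    rw [Matrix.inv_def, map_smul, smul_eq_mul, Ring.inverse_eq_inv]
  rw [h]
  exact (h1.matrix_det.continuousAt.inv₀ (isUnit_det_sub_smul_one hz).ne_zero).mul
    (hφ.comp h1.matrix_adjugate).continuousAt

theorem notMem_spectrum_of_mem_sphere (hs : spectrum ℂ A ⊆ Metric.ball c r) {z : ℂ}
    (hz : z ∈ Metric.sphere c r) : z ∉ spectrum ℂ A := fun h =>
  (Metric.mem_ball.mp (hs h)).ne (Metric.mem_sphere.mp hz)

theorem continuousOn_functional_resolvent (hs : spectrum ℂ A ⊆ Metric.ball c r)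
    (φ : Matrix (Fin n) (Fin n) ℂ →ₗ[ℂ] ℂ) :
    ContinuousOn (fun z : ℂ => φ (A - z • 1)⁻¹) (Metric.sphere c r) := fun _ hz =>
  (continuousAt_functional_resolvent φ (notMem_spectrum_of_mem_sphere hs hz)).continuousWithinAt

theorem linearMap_apply_eq_sum (φ : Matrix (Fin n) (Fin n) ℂ →ₗ[ℂ] ℂ)
    (B : Matrix (Fin n) (Fin n) ℂ) : φ B = ∑ i, ∑ j, φ (Matrix.single i j 1) * B i j := by
  conv_lhs => rw [Matrix.matrix_eq_sum_single B]
  simp only [map_sum]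
  refine Finset.sum_congr rfl fun i _ => Finset.sum_congr rfl fun j _ => ?_
  have : Matrix.single i j (B i j) = B i j • Matrix.single i j (1 : ℂ) := by simp
  rw [this, map_smul, smul_eq_mul, mul_comm]

/-- The functional `B ↦ B i j`. -/
def entryFunctional (i j : Fin n) : Matrix (Fin n) (Fin n) ℂ →ₗ[ℂ] ℂ where
  toFun B := B i j
  map_add' _ _ := rfl
  map_smul' _ _ := rfl

/-- A functional is a finite combination of entries, so it passes through the entrywise integral.
Matrix identities thereby reduce to scalar contour integrals, one for each `φ`. -/
theorem functional_cauchyIntegral (hr : 0 < r) (hs : spectrum ℂ A ⊆ Metric.ball c r)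
    (hf : ContinuousOn f (Metric.sphere c r)) (φ : Matrix (Fin n) (Fin n) ℂ →ₗ[ℂ] ℂ) :
    φ (cauchyIntegral f A c r) =
      -(1 / (2 * (π : ℂ) * Complex.I)) * ∮ z in C(c, r), f z * φ (A - z • 1)⁻¹ := by
  rw [linearMap_apply_eq_sum φ]
  have hint : ∀ i j, CircleIntegrable
      (fun z => φ (Matrix.single i j 1) * (f z * (A - z • (1 : Matrix (Fin n) (Fin n) ℂ))⁻¹ i j))
      c r := fun i j => by
    refine ContinuousOn.circleIntegrable hr.le ?_
    exact continuousOn_const.mul (hf.mul (continuousOn_functional_resolvent hs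
      (entryFunctional i j)))
  have h2 : ∀ z, f z * φ (A - z • 1)⁻¹ = ∑ i, ∑ j,
      φ (Matrix.single i j 1) * (f z * (A - z • (1 : Matrix (Fin n) (Fin n) ℂ))⁻¹ i j) := by
    intro z
    rw [linearMap_apply_eq_sum φ, Finset.mul_sum]
    refine Finset.sum_congr rfl fun i _ => ?_
    rw [Finset.mul_sum]
    exact Finset.sum_congr rfl fun j _ => by ring
  simp_rw [h2]
  rw [circleIntegral.integral_fun_sum, Finset.mul_sum]
  · refine Finset.sum_congr rfl fun i _ => ?_
    rw [circleIntegral.integral_fun_sum fun j _ => hint i j, Finset.mul_sum]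
    refine Finset.sum_congr rfl fun j _ => ?_
    rw [circleIntegral.integral_const_mul]
    simp only [cauchyIntegral, Matrix.of_apply]
    ring
  · exact fun i _ => CircleIntegrable.fun_sum _ fun j _ => hint i j

theorem ext_functional {B C : Matrix (Fin n) (Fin n) ℂ}
    (h : ∀ φ : Matrix (Fin n) (Fin n) ℂ →ₗ[ℂ] ℂ, φ B = φ C) : B = C := by
  ext i j
  exact h (entryFunctional i j)

theorem circleIntegral_mul_const (f : ℂ → ℂ) (a c : ℂ) (r : ℝ) :
    ∮ z in C(c, r), f z * a = (∮ z in C(c, r), f z) * a :=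
  circleIntegral.integral_smul_const f a c r

theorem AnalyticOnNhd.circleIntegral_eq_zero (hr : 0 < r)
    (hf : AnalyticOnNhd ℂ f (Metric.closedBall c r)) : ∮ z in C(c, r), f z = 0 :=
  Complex.circleIntegral_eq_zero_of_differentiable_on_off_countable hr.le Set.countable_empty
    hf.continuousOn fun z hz => (hf z (Metric.ball_subset_closedBall hz.1)).differentiableAt

theorem resolvent_mul_self {z : ℂ} (hz : z ∉ spectrum ℂ A) :
    z • (A - z • (1 : Matrix (Fin n) (Fin n) ℂ))⁻¹ = A * (A - z • 1)⁻¹ - 1 := by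
  have h := Matrix.mul_nonsing_inv _ (isUnit_det_sub_smul_one hz)
  rw [sub_mul, Matrix.smul_mul, one_mul] at h
  rw [eq_sub_iff_add_eq, ← eq_sub_iff_add_eq', h]

/-- Since `z (A - z)⁻¹ = A (A - z)⁻¹ - 1`, the two sides differ by a multiple of `∮ f`, which is
zero by Cauchy's theorem. -/
theorem cauchyIntegral_id_mul (hr : 0 < r) (hs : spectrum ℂ A ⊆ Metric.ball c r)
    (hf : AnalyticOnNhd ℂ f (Metric.closedBall c r)) :
    cauchyIntegral (fun z => z * f z) A c r = A * cauchyIntegral f A c r := by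
  have hfc : ContinuousOn f (Metric.sphere c r) :=
    hf.continuousOn.mono Metric.sphere_subset_closedBall
  refine ext_functional fun φ => ?_
  rw [functional_cauchyIntegral (f := fun z => z * f z) hr hs (continuousOn_id.mul hfc)]
  have := functional_cauchyIntegral hr hs hfc (φ ∘ₗ LinearMap.mulLeft ℂ A)
  simp only [LinearMap.comp_apply, LinearMap.mulLeft_apply] at this
  rw [this]
  congr 1
  have h0 : ∮ z in C(c, r), f z * φ 1 = 0 := by
    rw [circleIntegral_mul_const, hf.circleIntegral_eq_zero hr, zero_mul]
  rw [← sub_zero (∮ z in C(c, r), f z * φ (A * (A - z • 1)⁻¹)), ← h0,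
    ← circleIntegral.integral_sub]
  · refine circleIntegral.integral_congr hr.le fun z hz => ?_
    have := congrArg φ (resolvent_mul_self (notMem_spectrum_of_mem_sphere hs hz))
    rw [map_smul, map_sub, smul_eq_mul] at this
    linear_combination f z * this
  · exact (hfc.mul (continuousOn_functional_resolvent hs
      (φ ∘ₗ LinearMap.mulLeft ℂ A))).circleIntegrable hr.le
  · exact (hfc.mul continuousOn_const).circleIntegrable hr.le

theorem cauchyIntegral_add (hr : 0 < r) (hs : spectrum ℂ A ⊆ Metric.ball c r)
    (hf : AnalyticOnNhd ℂ f (Metric.closedBall c r))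
    (hg : AnalyticOnNhd ℂ g (Metric.closedBall c r)) :
    cauchyIntegral (fun z => f z + g z) A c r = cauchyIntegral f A c r + cauchyIntegral g A c r := by
  have hfc := hf.continuousOn.mono (Metric.sphere_subset_closedBall (x := c) (ε := r))
  have hgc := hg.continuousOn.mono (Metric.sphere_subset_closedBall (x := c) (ε := r))
  refine ext_functional fun φ => ?_
  rw [map_add, functional_cauchyIntegral hr hs hfc, functional_cauchyIntegral hr hs hgc,
    functional_cauchyIntegral (f := fun z => f z + g z) hr hs (hfc.add hgc), ← mul_add, ← circleIntegral.integral_add]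
  · simp only [add_mul]
  · exact (hfc.mul (continuousOn_functional_resolvent hs φ)).circleIntegrable hr.le
  · exact (hgc.mul (continuousOn_functional_resolvent hs φ)).circleIntegrable hr.le

theorem cauchyIntegral_const_mul (a : ℂ) (f : ℂ → ℂ) (A : Matrix (Fin n) (Fin n) ℂ) (c : ℂ)
    (r : ℝ) : cauchyIntegral (fun z => a * f z) A c r = a • cauchyIntegral f A c r := by
  ext i j
  simp only [cauchyIntegral, Matrix.of_apply, Matrix.smul_apply, mul_assoc,
    circleIntegral.integral_const_mul, smul_eq_mul]
  ring

theorem Polynomial.analyticOnNhd_eval (p : ℂ[X]) (s : Set ℂ) :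
    AnalyticOnNhd ℂ (fun z => p.eval z) s :=
  (Complex.analyticOnNhd_univ_iff_differentiable.mpr p.differentiable).mono (Set.subset_univ s)

theorem cauchyIntegral_polynomial_mul (hr : 0 < r) (hs : spectrum ℂ A ⊆ Metric.ball c r)
    (hf : AnalyticOnNhd ℂ f (Metric.closedBall c r)) (p : ℂ[X]) :
    cauchyIntegral (fun z => p.eval z * f z) A c r = aeval A p * cauchyIntegral f A c r := by
  induction p using Polynomial.induction_on with
  | C a => simp [cauchyIntegral_const_mul, Algebra.algebraMap_eq_smul_one]
  | add p q hp hq =>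
    simp only [eval_add, add_mul, map_add]
    rw [cauchyIntegral_add hr hs ((p.analyticOnNhd_eval _).mul hf)
      ((q.analyticOnNhd_eval _).mul hf), hp, hq]
  | monomial k a h =>
    have h2 : (fun z => (C a * X ^ (k + 1) : ℂ[X]).eval z * f z) =
        fun z => z * ((C a * X ^ k : ℂ[X]).eval z * f z) := by
      funext z
      simp only [eval_mul, eval_C, eval_pow, eval_X]
      ring
    rw [h2, cauchyIntegral_id_mul hr hs (((C a * X ^ k).analyticOnNhd_eval _).mul hf), h,
      ← mul_assoc]
    congr 1
    simp only [map_mul, aeval_C, map_pow, aeval_X, Algebra.algebraMap_eq_smul_one,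
      Matrix.smul_mul, one_mul, Matrix.mul_smul, pow_succ']

/-- With `u = (A - a) v` one has `(A - z)⁻¹ v = (z - a)⁻¹ ((A - z)⁻¹ u - v)`, and `u` is killed by
one power less. Each step raises the exponent of `(z - a)⁻¹`, so the induction on `N` needs all `m`
at once; only the simple pole has a nonzero integral. -/
theorem circleIntegral_resolvent_mulVec_of_pow_eq_zero (hr : 0 < r)
    (hs : spectrum ℂ A ⊆ Metric.ball c r) {a : ℂ} (ha : a ∈ Metric.ball c r) (i : Fin n) (N : ℕ) :
    ∀ (m : ℕ) (v : Fin n → ℂ), (A - a • 1) ^ N *ᵥ v = 0 →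
      ∮ z in C(c, r), ((z - a)⁻¹) ^ m * ((A - z • 1)⁻¹ *ᵥ v) i =
        if m = 0 then -(2 * π * Complex.I) * v i else 0 := by
  induction N with
  | zero =>
    intro m v hv
    have : v = 0 := by simpa using hv
    simp [this, circleIntegral]
  | succ N ih =>
    intro m v hv
    have hne : ∀ z ∈ Metric.sphere c r, z - a ≠ 0 := fun z hz h => by
      rw [sub_eq_zero.mp h] at hz
      exact (Metric.mem_ball.mp ha).ne (Metric.mem_sphere.mp hz)
    have hcont : ContinuousOn (fun z : ℂ => ((z - a)⁻¹) ^ (m + 1)) (Metric.sphere c r) :=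
      ((continuousOn_id.sub continuousOn_const).inv₀ hne).pow _
    let φ : (Fin n → ℂ) → Matrix (Fin n) (Fin n) ℂ →ₗ[ℂ] ℂ := fun u =>
      { toFun := fun B => (B *ᵥ u) i
        map_add' := fun B C => by simp [Matrix.add_mulVec]
        map_smul' := fun t B => by simp [Matrix.smul_mulVec] }
    set u := (A - a • (1 : Matrix (Fin n) (Fin n) ℂ)) *ᵥ v with hu
    have h1 : ∮ z in C(c, r), ((z - a)⁻¹) ^ m * ((A - z • 1)⁻¹ *ᵥ v) i =
        ∮ z in C(c, r), (((z - a)⁻¹) ^ (m + 1) * ((A - z • 1)⁻¹ *ᵥ u) i -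
          ((z - a)⁻¹) ^ (m + 1) * v i) := by
      refine circleIntegral.integral_congr hr.le fun z hz => ?_
      have hdet := isUnit_det_sub_smul_one (notMem_spectrum_of_mem_sphere hs hz)
      have hA : A - a • (1 : Matrix (Fin n) (Fin n) ℂ) = (A - z • 1) + (z - a) • 1 := by
        rw [sub_smul]; abel
      have : (A - z • (1 : Matrix (Fin n) (Fin n) ℂ))⁻¹ *ᵥ u =
          v + (z - a) • ((A - z • 1)⁻¹ *ᵥ v) := by
        rw [hu, hA, Matrix.mulVec_mulVec, mul_add, Matrix.nonsing_inv_mul _ hdet,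
          Matrix.add_mulVec, Matrix.one_mulVec, Matrix.mul_smul, mul_one, Matrix.smul_mulVec]
      simp only [this, Pi.add_apply, Pi.smul_apply, smul_eq_mul]
      have := hne z hz
      rw [pow_succ]
      field_simp
      ring
    rw [h1, circleIntegral.integral_sub, ih (m + 1) u, circleIntegral_mul_const]
    · rcases Nat.eq_zero_or_pos m with rfl | hm
      · simp [circleIntegral.integral_sub_inv_of_mem_ball ha]
      · have h3 : ∮ z in C(c, r), ((z - a)⁻¹) ^ (m + 1) = 0 := by
          have := circleIntegral.integral_sub_zpow_of_ne (n := -((m : ℤ) + 1)) (by omega) c a r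
          rw [← this]
          congr 1
          funext z
          rw [_root_.zpow_neg, inv_pow]
          norm_cast
        rw [h3, zero_mul, sub_zero, if_neg (Nat.succ_ne_zero m), if_neg hm.ne']
    · rw [hu, Matrix.mulVec_mulVec, ← pow_succ, hv]
    · exact (hcont.mul (continuousOn_functional_resolvent hs (φ u))).circleIntegrable hr.le
    · exact (hcont.mul continuousOn_const).circleIntegrable hr.le

/-- Generalized eigenvectors span the space, so it is enough to test on them. -/
theorem cauchyIntegral_one (hr : 0 < r) (hs : spectrum ℂ A ⊆ Metric.ball c r) :
    cauchyIntegral (fun _ => 1) A c r = 1 := by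
  suffices h : ∀ v : Fin n → ℂ, cauchyIntegral (fun _ => 1) A c r *ᵥ v = v by
    refine Matrix.ext_of_mulVec_single fun i => ?_
    rw [h, Matrix.one_mulVec]
  intro v
  have hv : v ∈ ⨆ a, Module.End.maxGenEigenspace (Matrix.toLin' A) a := by
    rw [Module.End.iSup_maxGenEigenspace_eq_top]; trivial
  induction hv using Submodule.iSup_induction' with
  | zero => simp
  | add x y _ _ hx hy => rw [Matrix.mulVec_add, hx, hy]
  | mem a x hx =>
    obtain ⟨N, hN⟩ := Module.End.mem_maxGenEigenspace _ _ _ |>.mp hx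
    have hN' : (A - a • 1) ^ N *ᵥ x = 0 := by
      have h1 : Matrix.toLin' A - a • (1 : Module.End ℂ (Fin n → ℂ)) =
          Matrix.toLin' (A - a • 1) := by
        rw [map_sub, map_smul, Matrix.toLin'_one]; rfl
      rw [h1, ← Matrix.toLin'_pow, Matrix.toLin'_apply] at hN
      exact hN
    by_cases ha : a ∈ Metric.ball c r
    · ext i
      let φ : Matrix (Fin n) (Fin n) ℂ →ₗ[ℂ] ℂ :=
        { toFun := fun B => (B *ᵥ x) i
          map_add' := fun B C => by simp [Matrix.add_mulVec]
          map_smul' := fun t B => by simp [Matrix.smul_mulVec] }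
      have h := functional_cauchyIntegral hr hs (continuousOn_const (c := (1 : ℂ))) φ
      have h2 := circleIntegral_resolvent_mulVec_of_pow_eq_zero hr hs ha i N 0 x hN'
      simp only [pow_zero, if_true] at h2
      have h3 : φ (cauchyIntegral (fun _ => 1) A c r) =
        (cauchyIntegral (fun _ => 1) A c r *ᵥ x) i := rfl
      rw [← h3, h]
      change -(1 / (2 * (π : ℂ) * Complex.I)) * (∮ z in C(c, r), 1 * ((A - z • 1)⁻¹ *ᵥ x) i) = _
      rw [h2]
      have : (π : ℂ) ≠ 0 := by exact_mod_cast Real.pi_ne_zero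
      field_simp [Complex.I_ne_zero]
    -- Here `a` is not in the spectrum, so `A - a` is invertible and its generalized eigenspace is
    -- trivial.
    · have hu := (isUnit_det_sub_smul_one fun h => ha (hs h)).pow N
      rw [← Matrix.det_pow] at hu
      have : x = 0 := by
        have h := congrArg (fun y => ((A - a • (1 : Matrix (Fin n) (Fin n) ℂ)) ^ N)⁻¹ *ᵥ y) hN'
        simpa [Matrix.mulVec_mulVec, Matrix.nonsing_inv_mul _ hu] using h
      simp [this]

theorem cauchyIntegral_polynomial (hr : 0 < r) (hs : spectrum ℂ A ⊆ Metric.ball c r) (p : ℂ[X]) :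
    cauchyIntegral (fun z => p.eval z) A c r = aeval A p := by
  have := cauchyIntegral_polynomial_mul hr hs (f := fun _ => 1) analyticOnNhd_const p
  simpa [cauchyIntegral_one hr hs] using this

theorem AnalyticOnNhd.dslope {s : Set ℂ} (hf : AnalyticOnNhd ℂ f s) {a : ℂ} (ha : a ∈ s) :
    AnalyticOnNhd ℂ (dslope f a) s := by
  have hU : IsOpen {z | AnalyticAt ℂ f z} := isOpen_analyticAt ℂ f
  have h1 : DifferentiableOn ℂ f {z | AnalyticAt ℂ f z} := fun z hz =>
    hz.differentiableAt.differentiableWithinAt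
  have h2 := (Complex.differentiableOn_dslope (hU.mem_nhds (hf a ha))).mpr h1
  exact (h2.analyticOnNhd hU).mono hf

/-- Newton interpolation with remainder: divide out one node at a time, `f z = f a + (z - a) *
dslope f a z`, where the divided difference stays analytic because the singularity is removable.
Repeated nodes cause no difficulty. -/
theorem exists_polynomial_add_prod_mul (hf : AnalyticOnNhd ℂ f (Metric.closedBall c r))
    (s : Multiset ℂ) (hs : ∀ a ∈ s, a ∈ Metric.closedBall c r) :
    ∃ (p : ℂ[X]) (g : ℂ → ℂ), AnalyticOnNhd ℂ g (Metric.closedBall c r) ∧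
      ∀ z, f z = p.eval z + (s.map fun a => X - C a).prod.eval z * g z := by
  induction s using Multiset.induction_on generalizing f with
  | empty => exact ⟨0, f, hf, by simp⟩
  | cons a s ih =>
    have ha := hs a (Multiset.mem_cons_self a s)
    obtain ⟨p, g, hg, h⟩ := ih (hf.dslope ha) fun b hb => hs b (Multiset.mem_cons_of_mem hb)
    refine ⟨C (f a) + (X - C a) * p, g, hg, fun z => ?_⟩
    have := sub_smul_dslope f a z
    rw [smul_eq_mul, h] at this
    simp only [eval_add, eval_C, eval_mul, eval_sub, eval_X, Multiset.map_cons,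
      Multiset.prod_cons]
    linear_combination -this

theorem exists_polynomial_add_charpoly_mul (hs : spectrum ℂ A ⊆ Metric.ball c r)
    (hf : AnalyticOnNhd ℂ f (Metric.closedBall c r)) :
    ∃ (p : ℂ[X]) (g : ℂ → ℂ), AnalyticOnNhd ℂ g (Metric.closedBall c r) ∧
      ∀ z, f z = p.eval z + A.charpoly.eval z * g z := by
  obtain ⟨p, g, hg, h⟩ := exists_polynomial_add_prod_mul hf A.charpoly.roots fun a ha =>
    Metric.ball_subset_closedBall (hs (Matrix.mem_spectrum_iff_isRoot_charpoly.mpr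
      (Polynomial.isRoot_of_mem_roots ha)))
  refine ⟨p, g, hg, fun z => ?_⟩
  rw [h, ← (IsAlgClosed.splits A.charpoly).eq_prod_roots_of_monic (Matrix.charpoly_monic A)]

/-- The remainder term disappears by Cayley–Hamilton. -/
theorem cauchyIntegral_polynomial_add_charpoly_mul (hr : 0 < r)
    (hs : spectrum ℂ A ⊆ Metric.ball c r) (hf : AnalyticOnNhd ℂ f (Metric.closedBall c r))
    (hg : AnalyticOnNhd ℂ g (Metric.closedBall c r)) (p : ℂ[X]) :
    cauchyIntegral (fun z => (p.eval z + A.charpoly.eval z * g z) * f z) A c r =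
      aeval A p * cauchyIntegral f A c r := by
  have : (fun z => (p.eval z + A.charpoly.eval z * g z) * f z) =
      fun z => p.eval z * f z + A.charpoly.eval z * (g z * f z) := by
    funext z; ring
  rw [this, cauchyIntegral_add hr hs ((p.analyticOnNhd_eval _).mul hf)
    ((A.charpoly.analyticOnNhd_eval _).mul (hg.mul hf)), cauchyIntegral_polynomial_mul hr hs hf,
    cauchyIntegral_polynomial_mul hr hs (hg.mul hf), Matrix.aeval_self_charpoly, zero_mul, add_zero]

/-- The polynomial interpolates `f` at the eigenvalues with multiplicity. The same `p` must serve
for every `g`: this gives multiplicativity, while `f(A) = p(A)` gives commutation with everything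
commuting with `A`. -/
theorem exists_cauchyIntegral_mul_eq (hr : 0 < r) (hs : spectrum ℂ A ⊆ Metric.ball c r)
    (hf : AnalyticOnNhd ℂ f (Metric.closedBall c r)) :
    ∃ p : ℂ[X], cauchyIntegral f A c r = aeval A p ∧
      ∀ g, AnalyticOnNhd ℂ g (Metric.closedBall c r) →
        cauchyIntegral (fun z => f z * g z) A c r = aeval A p * cauchyIntegral g A c r := by
  obtain ⟨p, h, hh, hp⟩ := exists_polynomial_add_charpoly_mul hs hf
  have key : ∀ g, AnalyticOnNhd ℂ g (Metric.closedBall c r) →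
      cauchyIntegral (fun z => f z * g z) A c r = aeval A p * cauchyIntegral g A c r :=
    fun g hg => by
      simp_rw [hp]
      exact cauchyIntegral_polynomial_add_charpoly_mul hr hs hg hh p
  refine ⟨p, ?_, key⟩
  have := key (fun _ => 1) analyticOnNhd_const
  simpa [cauchyIntegral_one hr hs] using this

theorem cauchyIntegral_mul (hr : 0 < r) (hs : spectrum ℂ A ⊆ Metric.ball c r)
    (hf : AnalyticOnNhd ℂ f (Metric.closedBall c r))
    (hg : AnalyticOnNhd ℂ g (Metric.closedBall c r)) :
    cauchyIntegral (fun z => f z * g z) A c r =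
      cauchyIntegral f A c r * cauchyIntegral g A c r := by
  obtain ⟨p, hp, h⟩ := exists_cauchyIntegral_mul_eq hr hs hf
  rw [h g hg, hp]

theorem commute_cauchyIntegral (hr : 0 < r) (hs : spectrum ℂ A ⊆ Metric.ball c r)
    (hf : AnalyticOnNhd ℂ f (Metric.closedBall c r)) {B : Matrix (Fin n) (Fin n) ℂ}
    (hB : Commute A B) : Commute (cauchyIntegral f A c r) B := by
  obtain ⟨p, hp, -⟩ := exists_cauchyIntegral_mul_eq hr hs hf
  rw [hp]
  clear hp
  induction p using Polynomial.induction_on' with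
  | add p q hp hq => rw [map_add]; exact Commute.add_left hp hq
  | monomial k a =>
    rw [aeval_monomial]
    exact Commute.mul_left (Algebra.commutes a B) (hB.pow_left k)

theorem cauchyIntegral_id_div_add (hr : 0 < r) (hs : spectrum ℂ A ⊆ Metric.ball c r) {t : ℂ}
    (ht : -t ∉ Metric.closedBall c r) :
    cauchyIntegral (fun z => z / (z + t)) A c r = A * (A + t • 1)⁻¹ := by
  have hne : ∀ z ∈ Metric.closedBall c r, z + t ≠ 0 := fun z hz h =>
    ht (by rwa [← eq_neg_of_add_eq_zero_left h])
  have hinv : AnalyticOnNhd ℂ (fun z => (z + t)⁻¹) (Metric.closedBall c r) :=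
    (analyticOnNhd_id.add analyticOnNhd_const).inv hne
  have h1 : (fun z : ℂ => z / (z + t)) = fun z => z * (z + t)⁻¹ := by
    funext z; rw [div_eq_mul_inv]
  rw [h1, cauchyIntegral_id_mul hr hs hinv]
  have h2 : cauchyIntegral (fun z => (z + t)⁻¹ * (X + C t : ℂ[X]).eval z) A c r = 1 := by
    have : cauchyIntegral (fun z => (z + t)⁻¹ * (X + C t : ℂ[X]).eval z) A c r =
        cauchyIntegral (fun _ => 1) A c r := by
      ext i j
      simp only [cauchyIntegral, Matrix.of_apply]
      congr 1
      refine circleIntegral.integral_congr hr.le fun z hz => ?_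
      have := hne z (Metric.sphere_subset_closedBall hz)
      simp [inv_mul_cancel₀ this]
    rw [this, cauchyIntegral_one hr hs]
  rw [cauchyIntegral_mul hr hs hinv ((X + C t).analyticOnNhd_eval _),
    cauchyIntegral_polynomial hr hs] at h2
  have h3 : aeval A (X + C t : ℂ[X]) = A + t • 1 := by
    simp [Algebra.algebraMap_eq_smul_one]
  rw [h3] at h2
  rw [Matrix.inv_eq_left_inv h2]

end

/-! ### The principal square root and its integral representation. -/

noncomputable section

open MeasureTheory Filter Topology

theorem principalSqrt_sq (z : ℂ) : principalSqrt z ^ 2 = z := by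
  have := Complex.cpow_nat_inv_pow z (n := 2) two_ne_zero
  simpa only [principalSqrt, one_div, Nat.cast_ofNat] using this

theorem principalSqrt_eq_exp {z : ℂ} (hz : z ≠ 0) :
    principalSqrt z = Complex.exp (Complex.log z / 2) := by
  rw [principalSqrt, Complex.cpow_def_of_ne_zero hz]
  congr 1
  ring

theorem principalSqrt_re_nonneg (z : ℂ) : 0 ≤ (principalSqrt z).re := by
  by_cases hz : z = 0
  · simp [hz, principalSqrt]
  · rw [principalSqrt_eq_exp hz, Complex.exp_re]
    refine mul_nonneg (Real.exp_pos _).le (Real.cos_nonneg_of_neg_pi_div_two_le_of_le ?_ ?_)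
    · have := Complex.neg_pi_lt_arg z
      simp [Complex.log_im]; linarith
    · have := Complex.arg_le_pi z
      simp [Complex.log_im]; linarith

theorem principalSqrt_re_pos {z : ℂ} (hz : z ∈ Complex.slitPlane) : 0 < (principalSqrt z).re := by
  refine (principalSqrt_re_nonneg z).lt_of_ne fun h => ?_
  have h2 := principalSqrt_sq z
  have hre := congrArg Complex.re h2
  have him := congrArg Complex.im h2
  simp only [sq, Complex.mul_re, Complex.mul_im, ← h] at hre him
  rcases hz with hz | hz
  · nlinarith [mul_self_nonneg (principalSqrt z).im]
  · apply hz; linarith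

theorem differentiableAt_principalSqrt {z : ℂ} (hz : z ∈ Complex.slitPlane) :
    DifferentiableAt ℂ principalSqrt z :=
  DifferentiableAt.cpow_const differentiableAt_id hz

/-- `matrixFun` uses an arbitrary admissible circle, so every such circle must be shown to avoid the
cut. At a point of the cut, approach from above and below forces the imaginary part of the root to
vanish; the root squares to a nonpositive real, so it is zero. Differentiating `√w * √w = w` there
would then give `0 = 1`. -/
theorem AnalyticAt.mem_slitPlane_of_principalSqrt {z : ℂ} (h : AnalyticAt ℂ principalSqrt z) :
    z ∈ Complex.slitPlane := by
  by_contra hz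
  rw [Complex.mem_slitPlane_iff, not_or, not_lt, not_not] at hz
  obtain ⟨hre, him⟩ := hz
  have hlim : ∀ s : ℝ, Tendsto (fun ε : ℝ => (principalSqrt (z + (s * ε : ℝ) * Complex.I)).im)
      (𝓝[>] 0) (𝓝 (principalSqrt z).im) := by
    intro s
    have h1 : Tendsto (fun ε : ℝ => z + (s * ε : ℝ) * Complex.I) (𝓝[>] 0) (𝓝 z) := by
      have : Continuous fun ε : ℝ => z + (s * ε : ℝ) * Complex.I := by fun_prop
      have := this.tendsto 0
      simp only [mul_zero, Complex.ofReal_zero, zero_mul, add_zero] at this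
      exact this.mono_left nhdsWithin_le_nhds
    exact (Complex.continuous_im.tendsto _).comp (h.continuousAt.tendsto.comp h1)
  have hsq : ∀ s ε : ℝ, 2 * ((principalSqrt (z + (s * ε : ℝ) * Complex.I)).re *
      (principalSqrt (z + (s * ε : ℝ) * Complex.I)).im) = s * ε := fun s ε => by
    have := congrArg Complex.im (principalSqrt_sq (z + (s * ε : ℝ) * Complex.I))
    rw [sq, Complex.mul_im] at this
    simp only [Complex.add_im, him, Complex.mul_im, Complex.ofReal_re, Complex.I_im,
      Complex.ofReal_im, Complex.I_re] at this
    linarith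
  have h0 : 0 ≤ (principalSqrt z).im := by
    refine ge_of_tendsto (hlim 1) ?_
    filter_upwards [self_mem_nhdsWithin] with ε hε
    have h1 := hsq 1 ε
    have h2 := principalSqrt_re_nonneg (z + (1 * ε : ℝ) * Complex.I)
    have h3 : (0 : ℝ) < ε := hε
    by_contra hc
    nlinarith
  have h1 : (principalSqrt z).im ≤ 0 := by
    refine le_of_tendsto (hlim (-1)) ?_
    filter_upwards [self_mem_nhdsWithin] with ε hε
    have h1 := hsq (-1) ε
    have h2 := principalSqrt_re_nonneg (z + (-1 * ε : ℝ) * Complex.I)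
    have h3 : (0 : ℝ) < ε := hε
    by_contra hc
    nlinarith
  have him0 := le_antisymm h1 h0
  have hsqz := principalSqrt_sq z
  have hre2 := congrArg Complex.re hsqz
  rw [sq, Complex.mul_re, him0] at hre2
  have hre0 : (principalSqrt z).re = 0 := by nlinarith
  have hs0 : principalSqrt z = 0 := Complex.ext hre0 him0
  have hd := h.differentiableAt.hasDerivAt
  have h2 := (hd.mul hd)
  have h3 : principalSqrt * principalSqrt = fun w => w := by
    funext w; rw [← sq]; exact principalSqrt_sq w
  rw [h3, hs0] at h2
  have := h2.unique (hasDerivAt_id z)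
  simp at this

/-- With `s = t / (1 + t)`, the quotient `(z + t) / (1 + t)` is the point `(1 - s) z + s` of the
segment from `z` to `1`. The slit plane is star-shaped about `1`, so the modulus has a positive
minimum on `K × [0, 1]`. -/
theorem IsCompact.exists_mul_one_add_le_norm_add {K : Set ℂ} (hK : IsCompact K)
    (hKs : K ⊆ Complex.slitPlane) :
    ∃ δ > 0, ∀ z ∈ K, ∀ t : ℝ, 0 ≤ t → δ * (1 + t) ≤ ‖z + t‖ := by
  rcases K.eq_empty_or_nonempty with rfl | hne
  · exact ⟨1, one_pos, by simp⟩
  have hcont : ContinuousOn (fun p : ℂ × ℝ => ‖((1 - p.2 : ℝ) : ℂ) * p.1 + (p.2 : ℂ)‖)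
      (K ×ˢ Set.Icc (0 : ℝ) 1) := by fun_prop
  obtain ⟨⟨z₀, s₀⟩, ⟨hz₀, hs₀⟩, hmin⟩ := (hK.prod isCompact_Icc).exists_isMinOn
    (hne.prod ⟨0, by simp⟩) hcont
  refine ⟨‖((1 - s₀ : ℝ) : ℂ) * z₀ + (s₀ : ℂ)‖, ?_, fun z hz t ht => ?_⟩
  · have := (starConvex_iff_segment_subset.mp Complex.starConvex_one_slitPlane (hKs hz₀))
      (show ((1 - s₀ : ℝ) : ℂ) * z₀ + (s₀ : ℂ) ∈ segment ℝ 1 z₀ from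
        ⟨s₀, 1 - s₀, hs₀.1, by linarith [hs₀.2], by ring, by
          simp [add_comm]⟩)
    exact norm_pos_iff.mpr (Complex.slitPlane_ne_zero this)
  · have h1 : 0 < 1 + t := by positivity
    have h2 : (z, t / (1 + t)) ∈ K ×ˢ Set.Icc (0 : ℝ) 1 :=
      ⟨hz, by positivity, (div_le_one h1).mpr (by linarith)⟩
    have h3 := hmin h2
    simp only [Set.mem_ofPred_eq] at h3
    have h4 : (z + t : ℂ) = ((1 + t : ℝ) : ℂ) *
        (((1 - t / (1 + t) : ℝ) : ℂ) * z + ((t / (1 + t) : ℝ) : ℂ)) := by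
      have : ((1 : ℂ) + t) ≠ 0 := by exact_mod_cast h1.ne'
      push_cast
      field_simp
      ring
    rw [h4, norm_mul, Complex.norm_real, Real.norm_of_nonneg h1.le, mul_comm]
    exact mul_le_mul_of_nonneg_left h3 h1.le

/-- The majorant for the Fubini argument; an antiderivative is `2 arctan √t`. -/
theorem integrableOn_inv_sqrt_mul_inv_one_add :
    IntegrableOn (fun t : ℝ => (√t)⁻¹ * (1 + t)⁻¹) (Set.Ioi 0) := by
  refine integrableOn_Ioi_deriv_of_nonneg (g := fun t => 2 * Real.arctan √t) (l := 2 * (π / 2))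
    (by fun_prop) (fun t ht => ?_) (fun t ht => ?_) ?_
  · have ht' : (0 : ℝ) < t := ht
    have h := ((Real.hasDerivAt_sqrt ht'.ne').arctan).const_mul 2
    refine h.congr_deriv ?_
    rw [Real.sq_sqrt ht'.le]
    have := (Real.sqrt_pos.mpr ht').ne'
    field_simp
  · have ht' : (0 : ℝ) < t := ht
    positivity
  · refine Tendsto.const_mul _ ?_
    exact (tendsto_nhds_of_tendsto_nhdsWithin Real.tendsto_arctan_atTop).comp
      Real.tendsto_sqrt_atTop

theorem norm_inv_sqrt_mul_div_le {z : ℂ} {δ Z t : ℝ} (hδ : 0 < δ) (hZ : ‖z‖ ≤ Z) (ht : 0 < t)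
    (h : δ * (1 + t) ≤ ‖z + t‖) :
    ‖((√t)⁻¹ : ℂ) * (z / (z + t))‖ ≤ Z / δ * ((√t)⁻¹ * (1 + t)⁻¹) := by
  have h1 : 0 < 1 + t := by positivity
  have h2 : ‖z / (z + t)‖ ≤ Z / (δ * (1 + t)) := by
    rw [norm_div]
    gcongr
    exact (norm_nonneg z).trans hZ
  rw [norm_mul, norm_inv, Complex.norm_real, Real.norm_of_nonneg (Real.sqrt_nonneg t)]
  calc (√t)⁻¹ * ‖z / (z + t)‖ ≤ (√t)⁻¹ * (Z / (δ * (1 + t))) := by gcongr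
    _ = _ := by field_simp

theorem integrableOn_inv_sqrt_mul_div {z : ℂ} (hz : z ∈ Complex.slitPlane) :
    IntegrableOn (fun t : ℝ => ((√t)⁻¹ : ℂ) * (z / (z + t))) (Set.Ioi 0) := by
  obtain ⟨δ, hδ, h⟩ := (isCompact_singleton (x := z)).exists_mul_one_add_le_norm_add
    (Set.singleton_subset_iff.mpr hz)
  refine Integrable.mono' (integrableOn_inv_sqrt_mul_inv_one_add.const_mul (‖z‖ / δ)) ?_ ?_
  · refine ContinuousOn.aestronglyMeasurable (fun t ht => ContinuousAt.continuousWithinAt ?_)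
      measurableSet_Ioi
    have ht' : (0 : ℝ) < t := ht
    have h1 : z + t ≠ 0 := norm_pos_iff.mp (lt_of_lt_of_le (by positivity) (h z rfl t ht'.le))
    have h2 : (√t : ℂ) ≠ 0 := by exact_mod_cast (Real.sqrt_pos.mpr ht').ne'
    fun_prop (disch := assumption)
  · filter_upwards [ae_restrict_mem measurableSet_Ioi] with t ht
    exact norm_inv_sqrt_mul_div_le hδ le_rfl ht (h z rfl t (le_of_lt ht))

/-- With `w = √z`, an antiderivative is `(w / i) (log (w + i√t) - log (w - i√t))`. Both arguments
stay in the right half-plane, so the principal logarithm is smooth along them. -/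
theorem integral_inv_sqrt_mul_div {z : ℂ} (hz : z ∈ Complex.slitPlane) :
    ∫ t in Set.Ioi (0 : ℝ), ((√t)⁻¹ : ℂ) * (z / (z + t)) = π * principalSqrt z := by
  set w := principalSqrt z with hw
  have hw0 : 0 < w.re := principalSqrt_re_pos hz
  have hzw : z = w ^ 2 := (principalSqrt_sq z).symm
  have hp : ∀ s : ℝ, w + s * Complex.I ∈ Complex.slitPlane := fun s => Or.inl (by simpa using hw0)
  have hm : ∀ s : ℝ, w - s * Complex.I ∈ Complex.slitPlane := fun s => Or.inl (by simpa using hw0)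
  have hG : ∀ t : ℝ, ContinuousAt (fun t : ℝ => w / Complex.I *
      (Complex.log (w + (√t : ℝ) * Complex.I) - Complex.log (w - (√t : ℝ) * Complex.I))) t := by
    intro t
    have h1 := hp (√t)
    have h2 := hm (√t)
    have := Real.continuous_sqrt.continuousAt (x := t)
    refine continuousAt_const.mul (ContinuousAt.sub ?_ ?_)
    · exact ContinuousAt.clog (by fun_prop) h1
    · exact ContinuousAt.clog (by fun_prop) h2
  have := integral_Ioi_of_hasDerivAt_of_tendsto (a := 0) (m := π * w)
    (f' := fun t : ℝ => ((√t)⁻¹ : ℂ) * (z / (z + t))) (hG 0).continuousWithinAt (fun t ht => ?_)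
    (integrableOn_inv_sqrt_mul_div hz) ?_
  · simpa using this
  · have ht' : (0 : ℝ) < t := ht
    have hs : HasDerivAt (fun t : ℝ => ((√t : ℝ) : ℂ)) ((1 / (2 * √t) : ℝ) : ℂ) t :=
      (Real.hasDerivAt_sqrt ht'.ne').ofReal_comp
    have h1 := ((hs.mul_const Complex.I).const_add w).clog_real (hp √t)
    have h2 := ((hs.mul_const Complex.I).const_sub w).clog_real (hm √t)
    refine ((h1.sub h2).const_mul (w / Complex.I)).congr_deriv ?_
    have e1 := Complex.slitPlane_ne_zero (hp √t)
    have e2 := Complex.slitPlane_ne_zero (hm √t)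
    have e3 : (√t : ℂ) ≠ 0 := by exact_mod_cast (Real.sqrt_pos.mpr ht').ne'
    have e4 : z + t = (w + (√t : ℝ) * Complex.I) * (w - (√t : ℝ) * Complex.I) := by
      have : ((√t : ℝ) : ℂ) ^ 2 = t := by exact_mod_cast Real.sq_sqrt ht'.le
      linear_combination hzw - this + (√t : ℂ) ^ 2 * Complex.I_sq
    have e5 : (w + (√t : ℝ) * Complex.I) + (w - (√t : ℝ) * Complex.I) = 2 * w := by ring
    rw [e4, hzw]
    push_cast
    generalize w + (√t : ℝ) * Complex.I = x at e1 e5 ⊢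
    generalize w - (√t : ℝ) * Complex.I = y at e2 e5 ⊢
    field_simp
    linear_combination w * e5
  · have h1 : Tendsto (fun t : ℝ => w * ((√t)⁻¹ : ℝ)) atTop (𝓝 0) := by
      have : Tendsto (fun t : ℝ => (√t)⁻¹) atTop (𝓝 0) :=
        Real.tendsto_sqrt_atTop.inv_tendsto_atTop
      have h := ((Complex.continuous_ofReal.tendsto 0).comp this).const_mul w
      simpa using h
    -- Scaling both arguments by the positive factor `1/√t` leaves the difference of logarithms
    -- unchanged; the limit is `log i - log (-i) = π i`.
    have h2 : Tendsto (fun t : ℝ => w / Complex.I * (Complex.log (w * ((√t)⁻¹ : ℝ) + Complex.I) -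
        Complex.log (w * ((√t)⁻¹ : ℝ) - Complex.I))) atTop (𝓝 (π * w)) := by
      have e : (π * w : ℂ) = w / Complex.I *
          (Complex.log (0 + Complex.I) - Complex.log (0 - Complex.I)) := by
        rw [zero_add, zero_sub, Complex.log_I, Complex.log_neg_I]
        field_simp [Complex.I_ne_zero]
        ring
      rw [e]
      refine Tendsto.const_mul _ (Tendsto.sub ?_ ?_)
      · exact (h1.add_const _).clog (by rw [zero_add]; exact Or.inr (by simp))
      · exact (h1.sub_const _).clog (by rw [zero_sub]; exact Or.inr (by simp))
    refine h2.congr' ?_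
    filter_upwards [eventually_gt_atTop 0] with t ht
    have hst := Real.sqrt_pos.mpr ht
    have e3 : (√t : ℂ) ≠ 0 := by exact_mod_cast hst.ne'
    have ep : w + (√t : ℝ) * Complex.I = (√t : ℝ) * (w * ((√t)⁻¹ : ℝ) + Complex.I) := by
      push_cast; field_simp
    have em : w - (√t : ℝ) * Complex.I = (√t : ℝ) * (w * ((√t)⁻¹ : ℝ) - Complex.I) := by
      push_cast; field_simp
    have np : w * ((√t)⁻¹ : ℝ) + Complex.I ≠ 0 := fun h => by
      rw [h, mul_zero] at ep; exact Complex.slitPlane_ne_zero (hp √t) ep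
    have nm : w * ((√t)⁻¹ : ℝ) - Complex.I ≠ 0 := fun h => by
      rw [h, mul_zero] at em; exact Complex.slitPlane_ne_zero (hm √t) em
    rw [ep, em, Complex.log_ofReal_mul hst np, Complex.log_ofReal_mul hst nm]
    ring

variable {n : ℕ} {A : Matrix (Fin n) (Fin n) ℂ} {c : ℂ} {r : ℝ}

theorem IsAdmissibleCircle.closedBall_subset_slitPlane
    (h : IsAdmissibleCircle principalSqrt A c r) : Metric.closedBall c r ⊆ Complex.slitPlane :=
  fun z hz => (h.2.2 z hz).mem_slitPlane_of_principalSqrt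

theorem IsAdmissibleCircle.integrable_uncurry (h : IsAdmissibleCircle principalSqrt A c r)
    (φ : Matrix (Fin n) (Fin n) ℂ →ₗ[ℂ] ℂ) :
    Integrable (Function.uncurry fun (θ t : ℝ) => deriv (circleMap c r) θ •
      (((√t)⁻¹ : ℂ) * (circleMap c r θ / (circleMap c r θ + t)) *
        φ (A - circleMap c r θ • 1)⁻¹))
      ((volume.restrict (Set.uIoc 0 (2 * π))).prod (volume.restrict (Set.Ioi 0))) := by
  obtain ⟨hr, hs, -⟩ := id h
  have hcs := h.closedBall_subset_slitPlane
  have hK : IsCompact (Metric.sphere c r) := isCompact_sphere c r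
  obtain ⟨δ, hδ, hδ'⟩ := hK.exists_mul_one_add_le_norm_add
    (Metric.sphere_subset_closedBall.trans hcs)
  obtain ⟨Z, hZ⟩ := hK.exists_bound_of_continuousOn (f := fun z : ℂ => z) continuousOn_id
  obtain ⟨P, hP⟩ := hK.exists_bound_of_continuousOn (continuousOn_functional_resolvent hs φ)
  have hmem : ∀ θ, circleMap c r θ ∈ Metric.sphere c r := circleMap_mem_sphere c hr.le
  have hφ : Continuous fun θ => φ (A - circleMap c r θ • 1)⁻¹ :=
    (continuousOn_functional_resolvent hs φ).comp_continuous (continuous_circleMap c r) hmem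
  have : IsFiniteMeasure (volume.restrict (Set.uIoc 0 (2 * π))) :=
    ⟨by simp [Set.uIoc]⟩
  have hbound := (integrable_const (r * (Z / δ) * P)
    (μ := volume.restrict (Set.uIoc 0 (2 * π)))).mul_prod integrableOn_inv_sqrt_mul_inv_one_add
  refine hbound.mono' ?_ ?_
  · rw [Measure.prod_restrict]
    refine ContinuousOn.aestronglyMeasurable ?_ (measurableSet_uIoc.prod measurableSet_Ioi)
    rintro ⟨θ, t⟩ ⟨-, ht⟩
    refine ContinuousAt.continuousWithinAt ?_
    have ht' : (0 : ℝ) < t := ht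
    have h1 : circleMap c r θ + t ≠ 0 :=
      norm_pos_iff.mp (lt_of_lt_of_le (by positivity) (hδ' _ (hmem θ) t ht'.le))
    have h2 : (√t : ℂ) ≠ 0 := by exact_mod_cast (Real.sqrt_pos.mpr ht').ne'
    simp only [Function.uncurry_def, deriv_circleMap]
    have c1 : ContinuousAt (fun p : ℝ × ℝ => φ (A - circleMap c r p.1 • 1)⁻¹) (θ, t) :=
      (hφ.comp continuous_fst).continuousAt
    have c2 : ContinuousAt (fun p : ℝ × ℝ => circleMap c r p.1) (θ, t) :=
      ((continuous_circleMap c r).comp continuous_fst).continuousAt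
    have c3 : ContinuousAt (fun p : ℝ × ℝ => circleMap 0 r p.1) (θ, t) :=
      ((continuous_circleMap 0 r).comp continuous_fst).continuousAt
    have c4 : ContinuousAt (fun p : ℝ × ℝ => ((√p.2 : ℝ) : ℂ)) (θ, t) := by fun_prop
    have c5 : ContinuousAt (fun p : ℝ × ℝ => (p.2 : ℂ)) (θ, t) := by fun_prop
    exact (c3.mul continuousAt_const).smul
      (((c4.inv₀ h2).mul (c2.div (c2.add c5) h1)).mul c1)
  · rw [Measure.prod_restrict]
    filter_upwards [ae_restrict_mem (measurableSet_uIoc.prod measurableSet_Ioi)]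
    rintro ⟨θ, t⟩ ⟨-, ht⟩
    have ht' : (0 : ℝ) < t := ht
    have h1 := norm_inv_sqrt_mul_div_le hδ (hZ _ (hmem θ)) ht' (hδ' _ (hmem θ) t ht'.le)
    have h2 := hP _ (hmem θ)
    simp only [Function.uncurry_apply_pair, norm_smul, deriv_circleMap]
    rw [norm_mul, norm_mul, Complex.norm_I, mul_one, norm_circleMap_zero, abs_of_pos hr]
    calc r * (‖((√t)⁻¹ : ℂ) * (circleMap c r θ / (circleMap c r θ + t))‖ *
          ‖φ (A - circleMap c r θ • 1)⁻¹‖)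
        ≤ r * (Z / δ * ((√t)⁻¹ * (1 + t)⁻¹) * P) := by
          gcongr
          exact (norm_nonneg _).trans h1
      _ = _ := by ring

theorem IsAdmissibleCircle.integral_functional_resolvent
    (h : IsAdmissibleCircle principalSqrt A c r) (φ : Matrix (Fin n) (Fin n) ℂ →ₗ[ℂ] ℂ)
    {t : ℝ} (ht : 0 < t) :
    ∫ θ in 0..2 * π, deriv (circleMap c r) θ •
      (((√t)⁻¹ : ℂ) * (circleMap c r θ / (circleMap c r θ + t)) *
        φ (A - circleMap c r θ • 1)⁻¹) =
      -(2 * π * Complex.I) * (((√t)⁻¹ : ℂ) * φ (A * (A + (t : ℂ) • 1)⁻¹)) := by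
  obtain ⟨hr, hs, -⟩ := id h
  have hcs := h.closedBall_subset_slitPlane
  have hnt : -(t : ℂ) ∉ Metric.closedBall c r := fun hm => by
    have := hcs hm
    rw [Complex.mem_slitPlane_iff] at this
    simp at this
    linarith
  have h1 : ContinuousOn (fun z : ℂ => z / (z + t)) (Metric.sphere c r) := by
    refine continuousOn_id.div (continuousOn_id.add continuousOn_const) fun z hz hzt => hnt ?_
    rw [← eq_neg_of_add_eq_zero_left hzt]
    exact Metric.sphere_subset_closedBall hz
  have h2 := functional_cauchyIntegral hr hs h1 φ
  rw [cauchyIntegral_id_div_add hr hs hnt] at h2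
  rw [h2, circleIntegral]
  have hpi : (π : ℂ) ≠ 0 := by exact_mod_cast Real.pi_ne_zero
  have h3 : ∀ θ : ℝ, deriv (circleMap c r) θ •
      (((√t)⁻¹ : ℂ) * (circleMap c r θ / (circleMap c r θ + t)) * φ (A - circleMap c r θ • 1)⁻¹) =
      ((√t)⁻¹ : ℂ) * (deriv (circleMap c r) θ •
      ((circleMap c r θ / (circleMap c r θ + t)) * φ (A - circleMap c r θ • 1)⁻¹)) := fun θ => by
    simp only [smul_eq_mul]; ring
  simp_rw [h3]
  rw [intervalIntegral.integral_const_mul]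
  field_simp [Complex.I_ne_zero]

theorem IsAdmissibleCircle.integrableOn_functional (h : IsAdmissibleCircle principalSqrt A c r)
    (φ : Matrix (Fin n) (Fin n) ℂ →ₗ[ℂ] ℂ) :
    IntegrableOn (fun t : ℝ => ((√t)⁻¹ : ℂ) * φ (A * (A + (t : ℂ) • 1)⁻¹)) (Set.Ioi 0) := by
  have h1 := (h.integrable_uncurry φ).integral_prod_right
  have h2 := h1.const_mul (-(2 * π * Complex.I))⁻¹
  refine h2.congr ?_
  filter_upwards [ae_restrict_mem measurableSet_Ioi] with t ht
  have h3 := h.integral_functional_resolvent φ ht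
  rw [intervalIntegral.integral_of_le Real.two_pi_pos.le] at h3
  rw [Set.uIoc_of_le Real.two_pi_pos.le]
  simp only [Function.uncurry_apply_pair]
  rw [h3]
  have hpi : (π : ℂ) ≠ 0 := by exact_mod_cast Real.pi_ne_zero
  field_simp [Complex.I_ne_zero]

/-- The integral representation `A^{1/2} = π⁻¹ ∫₀^∞ t^{-1/2} A (A + t)⁻¹ dt`. -/
theorem IsAdmissibleCircle.functional_principalSqrt
    (h : IsAdmissibleCircle principalSqrt A c r) (φ : Matrix (Fin n) (Fin n) ℂ →ₗ[ℂ] ℂ) :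
    φ (cauchyIntegral principalSqrt A c r) =
      (π : ℂ)⁻¹ * ∫ t in Set.Ioi (0 : ℝ), ((√t)⁻¹ : ℂ) * φ (A * (A + (t : ℂ) • 1)⁻¹) := by
  obtain ⟨hr, hs, hf⟩ := id h
  have hcs := h.closedBall_subset_slitPlane
  have hpi : (π : ℂ) ≠ 0 := by exact_mod_cast Real.pi_ne_zero
  rw [functional_cauchyIntegral hr hs (hf.continuousOn.mono Metric.sphere_subset_closedBall)]
  -- Fubini: the integral over `t` first produces `π √z` on the contour, while the contour integral
  -- first produces `A (A + t)⁻¹`.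
  have hswap := intervalIntegral_integral_swap (h.integrable_uncurry φ)
  have hl : ∀ θ : ℝ, ∫ t in Set.Ioi (0 : ℝ), deriv (circleMap c r) θ •
      (((√t)⁻¹ : ℂ) * (circleMap c r θ / (circleMap c r θ + t)) *
        φ (A - circleMap c r θ • 1)⁻¹) = π * (deriv (circleMap c r) θ •
      (principalSqrt (circleMap c r θ) * φ (A - circleMap c r θ • 1)⁻¹)) := fun θ => by
    rw [integral_smul, integral_mul_const, integral_inv_sqrt_mul_div
      (hcs (Metric.sphere_subset_closedBall (circleMap_mem_sphere c hr.le θ)))]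
    simp only [smul_eq_mul]; ring
  have hr' : ∫ t in Set.Ioi (0 : ℝ), (∫ θ in 0..2 * π, deriv (circleMap c r) θ •
      (((√t)⁻¹ : ℂ) * (circleMap c r θ / (circleMap c r θ + t)) *
        φ (A - circleMap c r θ • 1)⁻¹)) = -(2 * π * Complex.I) *
      ∫ t in Set.Ioi (0 : ℝ), ((√t)⁻¹ : ℂ) * φ (A * (A + (t : ℂ) • 1)⁻¹) := by
    rw [← integral_const_mul]
    exact setIntegral_congr_fun measurableSet_Ioi fun t ht =>
      h.integral_functional_resolvent φ ht
  simp_rw [hl] at hswap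
  rw [hr', intervalIntegral.integral_const_mul] at hswap
  rw [circleIntegral]
  have : ∫ t in Set.Ioi (0 : ℝ), ((√t)⁻¹ : ℂ) * φ (A * (A + (t : ℂ) • 1)⁻¹) =
      -(2 * π * Complex.I)⁻¹ * (π * ∫ θ in 0..2 * π, deriv (circleMap c r) θ •
      (principalSqrt (circleMap c r θ) * φ (A - circleMap c r θ • 1)⁻¹)) := by
    rw [hswap]
    field_simp [Complex.I_ne_zero]
  rw [this]
  field_simp

end

/-! ### The Arnoldi relation and the residuals of the shifted systems. -/

noncomputable section

open Matrix

variable {n : ℕ} (M : Matrix (Fin n) (Fin n) ℂ) (b : EuclideanSpace ℂ (Fin n))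

theorem toEuclideanLin_mul_apply {l m n : ℕ} (A : Matrix (Fin l) (Fin m) ℂ)
    (B : Matrix (Fin m) (Fin n) ℂ) (x : EuclideanSpace ℂ (Fin n)) :
    toEuclideanLin (A * B) x = toEuclideanLin A (toEuclideanLin B x) := by
  simp

theorem toEuclideanLin_one_apply (x : EuclideanSpace ℂ (Fin n)) :
    toEuclideanLin (1 : Matrix (Fin n) (Fin n) ℂ) x = x := by
  simp

theorem inner_toEuclideanLin_conjTranspose {m n : ℕ} (A : Matrix (Fin m) (Fin n) ℂ)
    (x : EuclideanSpace ℂ (Fin n)) (y : EuclideanSpace ℂ (Fin m)) :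
    inner ℂ x (toEuclideanLin Aᴴ y) = inner ℂ (toEuclideanLin A x) y := by
  rw [Matrix.toEuclideanLin_conjTranspose_eq_adjoint, LinearMap.adjoint_inner_right]

theorem arnoldiVec_zero : arnoldiVec M b 0 = ((‖b‖⁻¹ : ℝ) : ℂ) • b := by
  rw [arnoldiVec]

theorem arnoldiVec_succ (j : ℕ) : arnoldiVec M b (j + 1) =
    (((arnoldiSubdiag M b j)⁻¹ : ℝ) : ℂ) • arnoldiW M b (j + 1) j := by
  rw [arnoldiVec]; rfl

theorem arnoldiW_succ (i j : ℕ) : arnoldiW M b (i + 1) j =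
    arnoldiW M b i j - inner ℂ (arnoldiVec M b i) (arnoldiW M b i j) • arnoldiVec M b i := rfl

theorem arnoldiW_zero (j : ℕ) :
    arnoldiW M b 0 j = toEuclideanLin M (arnoldiVec M b j) := rfl

theorem toEuclideanLin_arnoldiVec (j m : ℕ) : toEuclideanLin M (arnoldiVec M b j) =
    ∑ i ∈ Finset.range m, inner ℂ (arnoldiVec M b i) (arnoldiW M b i j) • arnoldiVec M b i +
      arnoldiW M b m j := by
  induction m with
  | zero => simp [arnoldiW_zero]
  | succ m ih => rw [ih, Finset.sum_range_succ, arnoldiW_succ]; abel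

theorem arnoldiW_eq_smul_arnoldiVec (j : ℕ) :
    arnoldiW M b (j + 1) j = (arnoldiSubdiag M b j : ℂ) • arnoldiVec M b (j + 1) := by
  rw [arnoldiVec_succ, smul_smul]
  by_cases h : arnoldiSubdiag M b j = 0
  -- At breakdown the next vector is `0⁻¹ • 0 = 0`, so the identity survives.
  · have : arnoldiW M b (j + 1) j = 0 := norm_eq_zero.mp h
    simp [this]
  · rw [← Complex.ofReal_mul, mul_inv_cancel₀ h, Complex.ofReal_one, one_smul]

/-- Modified Gram–Schmidt: turn `m` removes the `q_m` component and, by orthonormality, leaves the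
earlier orthogonality intact. -/
theorem inner_arnoldiW_eq_zero (j m : ℕ)
    (ho : ∀ i < m, ∀ l < m, inner ℂ (arnoldiVec M b i) (arnoldiVec M b l) =
      if i = l then (1 : ℂ) else 0) (l : ℕ) (hl : l < m) :
    inner ℂ (arnoldiVec M b l) (arnoldiW M b m j) = 0 := by
  induction m with
  | zero => omega
  | succ m ih =>
    rw [arnoldiW_succ, inner_sub_right, inner_smul_right, ho l hl m (by omega)]
    rcases Nat.lt_succ_iff_lt_or_eq.mp hl with h | rfl
    · rw [ih (fun i hi l hl => ho i (by omega) l (by omega)) h, if_neg h.ne]; simp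
    · simp

variable {M b}

theorem inner_arnoldiVec (hb : b ≠ 0) (N : ℕ) (hN : ∀ i < N, arnoldiSubdiag M b i ≠ 0) :
    ∀ i < N + 1, ∀ l < N + 1, inner ℂ (arnoldiVec M b i) (arnoldiVec M b l) =
      if i = l then (1 : ℂ) else 0 := by
  induction N with
  | zero =>
    intro i hi l hl
    obtain rfl : i = 0 := by omega
    obtain rfl : l = 0 := by omega
    have : (‖b‖ : ℂ) ≠ 0 := by exact_mod_cast norm_ne_zero_iff.mpr hb
    rw [arnoldiVec_zero, inner_smul_left, inner_smul_right, inner_self_eq_norm_sq_to_K]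
    simp
    field_simp
  | succ N ih =>
    have ih := ih fun i hi => hN i (by omega)
    have hs := hN N (by omega)
    have hz : ∀ l < N + 1, inner ℂ (arnoldiVec M b l) (arnoldiVec M b (N + 1)) = 0 := fun l hl => by
      rw [arnoldiVec_succ, inner_smul_right, inner_arnoldiW_eq_zero M b N (N + 1) ih l hl, mul_zero]
    have h1 : inner ℂ (arnoldiVec M b (N + 1)) (arnoldiVec M b (N + 1)) = (1 : ℂ) := by
      rw [inner_self_eq_norm_sq_to_K, arnoldiVec_succ, norm_smul, Complex.norm_real, norm_inv]
      have : ‖arnoldiW M b (N + 1) N‖ = arnoldiSubdiag M b N := rfl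
      rw [this, Real.norm_of_nonneg (this ▸ norm_nonneg _), inv_mul_cancel₀ hs]
      simp
    intro i hi l hl
    rcases Nat.lt_succ_iff_lt_or_eq.mp hi with hi | rfl <;>
      rcases Nat.lt_succ_iff_lt_or_eq.mp hl with hl | rfl
    · exact ih i hi l hl
    · rw [hz i hi, if_neg hi.ne]
    · rw [← inner_conj_symm, hz l hl, if_neg hl.ne', map_zero]
    · rw [h1, if_pos rfl]

theorem Finset.eq_range_card_of_forall_lt_mem {s : Finset ℕ} (hs : ∀ j ∈ s, ∀ i < j, i ∈ s) :
    s = Finset.range s.card := by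
  refine Finset.eq_of_subset_of_card_le (fun j hj => ?_) (by simp)
  have : Finset.range (j + 1) ⊆ s := fun i hi => by
    rcases Nat.lt_succ_iff_lt_or_eq.mp (Finset.mem_range.mp hi) with h | rfl
    · exact hs j hj i h
    · exact hj
  have := Finset.card_le_card this
  rw [Finset.card_range] at this
  exact Finset.mem_range.mpr this

/-- The steps carried out form an initial segment of `ℕ`, so counting them gives the stopping index.
-/
theorem lt_arnoldiDim_iff {k j : ℕ} :
    j < arnoldiDim M b k ↔ j < k ∧ ∀ i < j, arnoldiSubdiag M b i ≠ 0 := by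
  classical
  have h := Finset.eq_range_card_of_forall_lt_mem
    (s := (Finset.range k).filter fun j => ∀ i < j, arnoldiSubdiag M b i ≠ 0) (by
      intro j hj i hij
      rw [Finset.mem_filter, Finset.mem_range] at hj ⊢
      exact ⟨hij.trans hj.1, fun l hl => hj.2 l (hl.trans hij)⟩)
  have h2 : (j ∈ (Finset.range k).filter fun j => ∀ i < j, arnoldiSubdiag M b i ≠ 0) ↔
      j < arnoldiDim M b k := by
    rw [h, Finset.mem_range, arnoldiDim]
  rw [← h2, Finset.mem_filter, Finset.mem_range]

theorem arnoldiDim_le (k : ℕ) : arnoldiDim M b k ≤ k := by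
  by_contra! h
  exact lt_irrefl _ (lt_arnoldiDim_iff.mp h).1

theorem arnoldiDim_pos {k : ℕ} (hk : 0 < k) : 0 < arnoldiDim M b k :=
  lt_arnoldiDim_iff.mpr ⟨hk, fun i hi => absurd hi (Nat.not_lt_zero i)⟩

theorem arnoldiSubdiag_eq_zero {k : ℕ} (h : arnoldiDim M b k < k) :
    arnoldiSubdiag M b (arnoldiDim M b k - 1) = 0 := by
  have h1 : ¬ (arnoldiDim M b k < arnoldiDim M b k) := lt_irrefl _
  rw [lt_arnoldiDim_iff] at h1
  push Not at h1
  obtain ⟨i, hi, h0⟩ := h1 h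
  have h2 : ∀ l < arnoldiDim M b k - 1, arnoldiSubdiag M b l ≠ 0 :=
    (lt_arnoldiDim_iff.mp (show arnoldiDim M b k - 1 < arnoldiDim M b k by omega)).2
  have : i = arnoldiDim M b k - 1 := by
    by_contra hne
    exact h2 i (by omega) h0
  rwa [← this]

theorem inner_arnoldiVec_of_lt_arnoldiDim (hb : b ≠ 0) {k i l : ℕ} (hi : i < arnoldiDim M b k)
    (hl : l < arnoldiDim M b k) : inner ℂ (arnoldiVec M b i) (arnoldiVec M b l) =
      if i = l then (1 : ℂ) else 0 :=
  inner_arnoldiVec hb (max i l) (lt_arnoldiDim_iff.mp (max_lt hi hl)).2 i (by omega) l (by omega)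

theorem inner_arnoldiVec_arnoldiDim (hb : b ≠ 0) {k l : ℕ} (hk : 0 < k)
    (hl : l < arnoldiDim M b k) :
    inner ℂ (arnoldiVec M b l) (arnoldiVec M b (arnoldiDim M b k)) = 0 := by
  have hm := arnoldiDim_pos (M := M) (b := b) hk
  obtain ⟨m, hm⟩ : ∃ m, arnoldiDim M b k = m + 1 := ⟨arnoldiDim M b k - 1, by omega⟩
  rw [hm, arnoldiVec_succ, inner_smul_right, inner_arnoldiW_eq_zero M b m (m + 1), mul_zero]
  · exact fun i hi l hl => inner_arnoldiVec_of_lt_arnoldiDim (k := k) hb (by omega) (by omega)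
  · omega

/-- The remainder `h_{m+1,m} q_{m+1} e_m^T` of the Arnoldi relation. -/
def arnoldiRemainder (M : Matrix (Fin n) (Fin n) ℂ) (b : EuclideanSpace ℂ (Fin n)) (k : ℕ) :
    Matrix (Fin n) (Fin (arnoldiDim M b k)) ℂ :=
  Matrix.of fun i j => if j.val + 1 = arnoldiDim M b k then
    (arnoldiSubdiag M b (arnoldiDim M b k - 1) : ℂ) * arnoldiVec M b (arnoldiDim M b k) i else 0

/-- The sum expressing `M q_j` ends at `q_{j+1}`, which is a column of `Q` except when `j` is the
last index; that term is the remainder. -/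
theorem mul_arnoldiQ (k : ℕ) : M * arnoldiQ M b k =
    arnoldiQ M b k * arnoldiH M b k + arnoldiRemainder M b k := by
  ext i j
  have h1 : (M * arnoldiQ M b k) i j = (toEuclideanLin M (arnoldiVec M b j.val)) i := by
    simp [Matrix.mul_apply, arnoldiQ, Matrix.toLpLin_apply, Matrix.mulVec, dotProduct]
  have h2 : (arnoldiQ M b k * arnoldiH M b k) i j = ∑ l ∈ Finset.range (arnoldiDim M b k),
      arnoldiVec M b l i * (if l ≤ j.val then inner ℂ (arnoldiVec M b l) (arnoldiW M b l j.val)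
        else if l = j.val + 1 then (arnoldiSubdiag M b j.val : ℂ) else 0) := by
    rw [Finset.sum_range]
    simp [Matrix.mul_apply, arnoldiQ, arnoldiH]
  have h3 : ∑ l ∈ Finset.range (j.val + 1),
      arnoldiVec M b l i * (if l ≤ j.val then inner ℂ (arnoldiVec M b l) (arnoldiW M b l j.val)
        else if l = j.val + 1 then (arnoldiSubdiag M b j.val : ℂ) else 0) =
      (∑ l ∈ Finset.range (j.val + 1),
        inner ℂ (arnoldiVec M b l) (arnoldiW M b l j.val) • arnoldiVec M b l) i := by
    rw [WithLp.ofLp_sum, Finset.sum_apply]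
    refine Finset.sum_congr rfl fun l hl => ?_
    rw [if_pos (Nat.lt_succ_iff.mp (Finset.mem_range.mp hl)), PiLp.smul_apply, smul_eq_mul,
      mul_comm]
  have h4 : (toEuclideanLin M (arnoldiVec M b j.val)) i = (∑ l ∈ Finset.range (j.val + 1),
        inner ℂ (arnoldiVec M b l) (arnoldiW M b l j.val) • arnoldiVec M b l) i +
        (arnoldiSubdiag M b j.val : ℂ) * arnoldiVec M b (j.val + 1) i := by
    rw [toEuclideanLin_arnoldiVec M b j.val (j.val + 1), arnoldiW_eq_smul_arnoldiVec,
      PiLp.add_apply, PiLp.smul_apply, smul_eq_mul]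
  rw [Matrix.add_apply, h1, h2, h4, arnoldiRemainder, Matrix.of_apply]
  by_cases hj : j.val + 1 = arnoldiDim M b k
  · have hj' : arnoldiDim M b k - 1 = j.val := by omega
    rw [if_pos hj, hj', show Finset.range (arnoldiDim M b k) = Finset.range (j.val + 1) by rw [hj],
      show arnoldiVec M b (arnoldiDim M b k) = arnoldiVec M b (j.val + 1) by rw [hj], h3]
  · have hsub := Finset.sum_subset (s₁ := Finset.range (j.val + 1 + 1))
      (s₂ := Finset.range (arnoldiDim M b k)) (f := fun l => arnoldiVec M b l i *
        (if l ≤ j.val then inner ℂ (arnoldiVec M b l) (arnoldiW M b l j.val)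
          else if l = j.val + 1 then (arnoldiSubdiag M b j.val : ℂ) else 0))
      (by
        intro l hl
        have := j.isLt
        rw [Finset.mem_range] at hl ⊢
        omega)
      (by
        intro l _ hl
        rw [Finset.mem_range] at hl
        rw [if_neg (by omega), if_neg (by omega), mul_zero])
    rw [if_neg hj, add_zero, ← hsub, Finset.sum_range_succ _ (j.val + 1), h3,
      if_neg (Nat.not_succ_le_self _), if_pos rfl, mul_comm]

theorem conjTranspose_arnoldiQ_mul_self (hb : b ≠ 0) (k : ℕ) :
    (arnoldiQ M b k)ᴴ * arnoldiQ M b k = 1 := by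
  ext i j
  have := inner_arnoldiVec_of_lt_arnoldiDim hb i.isLt j.isLt
  rw [PiLp.inner_apply] at this
  simp only [RCLike.inner_apply, ← Fin.ext_iff] at this
  rw [Matrix.one_apply, ← this]
  simp [Matrix.mul_apply, arnoldiQ, mul_comm]

theorem conjTranspose_arnoldiQ_mul_arnoldiRemainder (hb : b ≠ 0) {k : ℕ} (hk : 0 < k) :
    (arnoldiQ M b k)ᴴ * arnoldiRemainder M b k = 0 := by
  ext i j
  have := inner_arnoldiVec_arnoldiDim hb hk i.isLt
  rw [PiLp.inner_apply] at this
  simp only [RCLike.inner_apply] at this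
  simp only [Matrix.mul_apply, arnoldiQ, arnoldiRemainder, Matrix.conjTranspose_apply,
    Matrix.of_apply, Matrix.zero_apply]
  by_cases hj : j.val + 1 = arnoldiDim M b k
  · simp only [if_pos hj]
    rw [← mul_zero (arnoldiSubdiag M b (arnoldiDim M b k - 1) : ℂ), ← this, Finset.mul_sum]
    refine Finset.sum_congr rfl fun l _ => ?_
    rw [RCLike.star_def]
    ring
  · simp [hj]

/-- As a compression of `M` to the Krylov space, `H` inherits positive definiteness and the bound on
quadratic forms. -/
theorem arnoldiH_eq (hb : b ≠ 0) {k : ℕ} (hk : 0 < k) :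
    arnoldiH M b k = (arnoldiQ M b k)ᴴ * (M * arnoldiQ M b k) := by
  rw [mul_arnoldiQ, Matrix.mul_add, conjTranspose_arnoldiQ_mul_arnoldiRemainder hb hk,
    ← Matrix.mul_assoc, conjTranspose_arnoldiQ_mul_self hb, one_mul, add_zero]

/-- The vector `‖b‖ e_1` in the coordinates of the Krylov basis. -/
def arnoldiStart (M : Matrix (Fin n) (Fin n) ℂ) (b : EuclideanSpace ℂ (Fin n)) (k : ℕ) :
    EuclideanSpace ℂ (Fin (arnoldiDim M b k)) :=
  WithLp.toLp 2 fun i => if i.val = 0 then (‖b‖ : ℂ) else 0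

theorem arnoldiQ_arnoldiStart (hb : b ≠ 0) {k : ℕ} (hk : 0 < k) :
    toEuclideanLin (arnoldiQ M b k) (arnoldiStart M b k) = b := by
  ext i
  have hm := arnoldiDim_pos (M := M) (b := b) hk
  have hb' : (‖b‖ : ℂ) ≠ 0 := by exact_mod_cast norm_ne_zero_iff.mpr hb
  have : (toEuclideanLin (arnoldiQ M b k) (arnoldiStart M b k)) i =
      ∑ j : Fin (arnoldiDim M b k), arnoldiVec M b j.val i *
        (if j.val = 0 then (‖b‖ : ℂ) else 0) := by
    simp [Matrix.toLpLin_apply, Matrix.mulVec, dotProduct, arnoldiQ, arnoldiStart]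
  rw [this, Finset.sum_eq_single (⟨0, hm⟩ : Fin (arnoldiDim M b k))]
  · simp [arnoldiVec_zero]
    field_simp
  · intro j _ hj
    rw [if_neg fun h => hj (Fin.ext h), mul_zero]
  · simp

theorem conjTranspose_arnoldiQ_apply (hb : b ≠ 0) {k : ℕ} (hk : 0 < k) :
    toEuclideanLin (arnoldiQ M b k)ᴴ b = arnoldiStart M b k := by
  have h := congrArg (toEuclideanLin (arnoldiQ M b k)ᴴ) (arnoldiQ_arnoldiStart (M := M) hb hk)
  rwa [← toEuclideanLin_mul_apply, conjTranspose_arnoldiQ_mul_self hb, toEuclideanLin_one_apply,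
    eq_comm] at h

/-- Deleting the first row and last column of a Hessenberg matrix leaves an upper triangular one
with the subdiagonal on its diagonal. A shift by `z` does not change the subdiagonal. -/
theorem adjugate_sub_smul_one_of_isHessenberg {m : ℕ} (H : Matrix (Fin m) (Fin m) ℂ)
    (hH : ∀ i j : Fin m, j.val + 1 < i.val → H i j = 0) (hm : 0 < m) (z : ℂ) :
    (H - z • (1 : Matrix (Fin m) (Fin m) ℂ)).adjugate ⟨m - 1, by omega⟩ ⟨0, hm⟩ =
      H.adjugate ⟨m - 1, by omega⟩ ⟨0, hm⟩ := by
  obtain ⟨m, rfl⟩ : ∃ m', m = m' + 1 := ⟨m - 1, by omega⟩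
  have key : ∀ G : Matrix (Fin (m + 1)) (Fin (m + 1)) ℂ,
      (∀ i j : Fin (m + 1), j.val + 1 < i.val → G i j = 0) →
      G.adjugate (Fin.last m) 0 = (-1) ^ m * ∏ i : Fin m, G i.succ i.castSucc := by
    intro G hG
    rw [Matrix.adjugate_fin_succ_eq_det_submatrix, Matrix.det_of_isUpperTriangular]
    · simp
    · intro i j hij
      refine hG _ _ ?_
      simpa using hij
  have h1 := key H hH
  have h2 := key (H - z • 1) fun i j hij => by
    have : i ≠ j := fun h => by rw [h] at hij; omega
    simp [hH i j hij, Matrix.one_apply_ne this]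
  have e : (⟨m + 1 - 1, by omega⟩ : Fin (m + 1)) = Fin.last m := rfl
  rw [e]
  change (H - z • (1 : Matrix (Fin (m + 1)) (Fin (m + 1)) ℂ)).adjugate (Fin.last m) 0 =
    H.adjugate (Fin.last m) 0
  rw [h1, h2]
  congr 1
  refine Finset.prod_congr rfl fun i _ => ?_
  have : i.succ ≠ i.castSucc := fun h => by
    have := congrArg Fin.val h
    simp at this
  simp [Matrix.one_apply_ne this]

/-- The residual of the full orthogonalization method, multiplied by `det (H - z)`, does not
depend on the shift. -/
def arnoldiResidual (M : Matrix (Fin n) (Fin n) ℂ) (b : EuclideanSpace ℂ (Fin n)) (k : ℕ) :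
    EuclideanSpace ℂ (Fin n) :=
  if hm : 0 < arnoldiDim M b k then
    -((arnoldiH M b k).adjugate ⟨arnoldiDim M b k - 1, by omega⟩ ⟨0, hm⟩ * ‖b‖ *
      arnoldiSubdiag M b (arnoldiDim M b k - 1)) • arnoldiVec M b (arnoldiDim M b k)
  else 0

theorem arnoldiResidual_eq_zero {k : ℕ} (h : arnoldiDim M b k < k) :
    arnoldiResidual M b k = 0 := by
  simp [arnoldiResidual, arnoldiSubdiag_eq_zero h]

theorem arnoldiH_eq_zero {k : ℕ} {i j : Fin (arnoldiDim M b k)} (h : j.val + 1 < i.val) :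
    arnoldiH M b k i j = 0 := by
  rw [arnoldiH, Matrix.of_apply, if_neg (by omega), if_neg (by omega)]

/-- By the Arnoldi relation the residual is minus the remainder applied to `(H - z)⁻¹ ‖b‖ e₁`. The
remainder sees only the last coordinate, so a single corner entry of the adjugate survives. -/
theorem det_smul_sub_fomError (hb : b ≠ 0) {k : ℕ} (hk : 0 < k) {z : ℂ}
    (hM : IsUnit (M - z • (1 : Matrix (Fin n) (Fin n) ℂ)).det)
    (hH : IsUnit (arnoldiH M b k - z • 1).det) :
    (arnoldiH M b k - z • 1).det • toEuclideanLin (M - z • 1) (fomError M b k z) =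
      arnoldiResidual M b k := by
  have hm := arnoldiDim_pos (M := M) (b := b) hk
  set H := arnoldiH M b k with hHdef
  set Q := arnoldiQ M b k
  have h1 : (M - z • 1) * (Q * (H - z • 1)⁻¹) = Q + arnoldiRemainder M b k * (H - z • 1)⁻¹ := by
    rw [← Matrix.mul_assoc, Matrix.sub_mul, mul_arnoldiQ, Matrix.smul_mul, Matrix.one_mul]
    have : Q * H + arnoldiRemainder M b k - z • Q =
        Q * (H - z • 1) + arnoldiRemainder M b k := by
      rw [Matrix.mul_sub, Matrix.mul_smul, Matrix.mul_one]; abel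
    rw [this, Matrix.add_mul, Matrix.mul_assoc, Matrix.mul_nonsing_inv _ hH, Matrix.mul_one]
  have hinv : (H - z • 1).det • (H - z • 1)⁻¹ = (H - z • 1).adjugate := by
    rw [Matrix.inv_def, smul_smul, Ring.mul_inverse_cancel _ hH, one_smul]
  have h2 : toEuclideanLin (M - z • 1) (fomError M b k z) =
      - toEuclideanLin (arnoldiRemainder M b k * (H - z • 1)⁻¹) (arnoldiStart M b k) := by
    rw [fomError, map_sub, ← toEuclideanLin_mul_apply, ← toEuclideanLin_mul_apply,
      Matrix.mul_nonsing_inv _ hM, toEuclideanLin_one_apply, h1, map_add, LinearMap.add_apply]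
    change b - (toEuclideanLin Q (arnoldiStart M b k) + _) = _
    rw [arnoldiQ_arnoldiStart hb hk]
    simp only [sub_add_cancel_left]
    rfl
  rw [h2, smul_neg, ← LinearMap.smul_apply, ← map_smul, ← Matrix.mul_smul, hinv,
    arnoldiResidual, dif_pos hm, neg_smul]
  congr 1
  ext i
  have h3 : (toEuclideanLin (arnoldiRemainder M b k * (H - z • 1).adjugate)
      (arnoldiStart M b k)) i = ∑ j, (∑ l, arnoldiRemainder M b k i l *
        (H - z • 1).adjugate l j) * (if j.val = 0 then (‖b‖ : ℂ) else 0) := by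
    simp [Matrix.toLpLin_apply, Matrix.mulVec, dotProduct, arnoldiStart, Matrix.mul_apply]
  rw [h3, Finset.sum_eq_single (⟨0, hm⟩ : Fin (arnoldiDim M b k)),
    Finset.sum_eq_single (⟨arnoldiDim M b k - 1, by omega⟩ : Fin (arnoldiDim M b k)),
    adjugate_sub_smul_one_of_isHessenberg H (fun i j => arnoldiH_eq_zero) hm z]
  · rw [arnoldiRemainder, Matrix.of_apply, if_pos (Nat.sub_add_cancel hm), if_pos rfl,
      PiLp.smul_apply, smul_eq_mul]
    ring
  · intro l _ hl
    rw [arnoldiRemainder, Matrix.of_apply, if_neg, zero_mul]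
    exact fun h => hl (Fin.ext (by simp; omega))
  · simp
  · intro j _ hj
    rw [if_neg fun h => hj (Fin.ext h), mul_zero]
  · simp

end

/-! ### Positive-definite matrices and their square roots. -/

noncomputable section

open Matrix MeasureTheory

/-- Expand `‖T x‖²` in an eigenbasis of `T* T`, whose eigenvalues are the squared singular values.
-/
theorem LinearMap.norm_apply_le_singularValues_zero_mul {𝕜 E F : Type*} [RCLike 𝕜]
    [NormedAddCommGroup E] [InnerProductSpace 𝕜 E] [FiniteDimensional 𝕜 E]
    [NormedAddCommGroup F] [InnerProductSpace 𝕜 F] [FiniteDimensional 𝕜 F]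
    (T : E →ₗ[𝕜] F) (x : E) : ‖T x‖ ≤ T.singularValues 0 * ‖x‖ := by
  set hS := T.isSymmetric_adjoint_comp_self
  set e := hS.eigenvectorBasis rfl with he
  refine le_of_sq_le_sq ?_ (mul_nonneg (T.singularValues_nonneg 0) (norm_nonneg x))
  have h1 : inner 𝕜 x ((adjoint T ∘ₗ T) x) =
      ∑ i, ((hS.eigenvalues rfl i * ‖inner 𝕜 (e i) x‖ ^ 2 : ℝ) : 𝕜) := by
    rw [← e.sum_inner_mul_inner]
    refine Finset.sum_congr rfl fun i _ => ?_
    rw [← hS (e i) x, he, hS.apply_eigenvectorBasis, ← he, inner_smul_left, RCLike.conj_ofReal,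
      mul_left_comm, ← inner_conj_symm x (e i), RCLike.conj_mul]
    push_cast
    rfl
  have h2 : ‖T x‖ ^ 2 = ∑ i, hS.eigenvalues rfl i * ‖inner 𝕜 (e i) x‖ ^ 2 := by
    rw [LinearMap.comp_apply, LinearMap.adjoint_inner_right, inner_self_eq_norm_sq_to_K] at h1
    exact_mod_cast h1
  rw [h2, mul_pow, ← e.sum_sq_norm_inner_right x, Finset.mul_sum]
  refine Finset.sum_le_sum fun i _ => mul_le_mul_of_nonneg_right ?_ (sq_nonneg _)
  rw [← T.sq_singularValues_fin rfl i]
  exact pow_le_pow_left₀ (T.singularValues_nonneg i) (T.singularValues_antitone (Nat.zero_le _)) 2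

variable {n : ℕ} {A : Matrix (Fin n) (Fin n) ℂ}

theorem sigmaMax_nonneg (A : Matrix (Fin n) (Fin n) ℂ) : 0 ≤ sigmaMax A :=
  LinearMap.singularValues_nonneg _ 0

theorem norm_toEuclideanLin_le_sigmaMax (A : Matrix (Fin n) (Fin n) ℂ)
    (x : EuclideanSpace ℂ (Fin n)) : ‖toEuclideanLin A x‖ ≤ sigmaMax A * ‖x‖ :=
  LinearMap.norm_apply_le_singularValues_zero_mul _ x

theorem IsPosDef.re_inner_pos (hA : IsPosDef A) {x : EuclideanSpace ℂ (Fin n)} (hx : x ≠ 0) :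
    0 < (inner ℂ x (toEuclideanLin A x)).re := by
  have hn : 0 < ‖x‖ := norm_pos_iff.mpr hx
  have h := hA (((‖x‖⁻¹ : ℝ) : ℂ) • x) (by
    rw [norm_smul, Complex.norm_real, Real.norm_of_nonneg (by positivity),
      inv_mul_cancel₀ hn.ne'])
  rw [map_smul, inner_smul_left, inner_smul_right, Complex.conj_ofReal, Complex.re_ofReal_mul,
    Complex.re_ofReal_mul] at h
  exact pos_of_mul_pos_right (pos_of_mul_pos_right h (by positivity)) (by positivity)

theorem IsPosDef.re_inner_nonneg (hA : IsPosDef A) (x : EuclideanSpace ℂ (Fin n)) :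
    0 ≤ (inner ℂ x (toEuclideanLin A x)).re := by
  rcases eq_or_ne x 0 with rfl | hx
  · simp
  · exact (hA.re_inner_pos hx).le

theorem exists_eigenvector_of_mem_spectrum {z : ℂ} (hz : z ∈ spectrum ℂ A) :
    ∃ v : EuclideanSpace ℂ (Fin n), v ≠ 0 ∧ toEuclideanLin A v = z • v := by
  rw [← Matrix.spectrum_toLpLin 2, ← Module.End.hasEigenvalue_iff_mem_spectrum] at hz
  obtain ⟨v, hv⟩ := hz.exists_hasEigenvector
  exact ⟨v, hv.2, hv.apply_eq_smul⟩

theorem IsPosDef.re_pos_of_mem_spectrum (hA : IsPosDef A) {z : ℂ} (hz : z ∈ spectrum ℂ A) :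
    0 < z.re := by
  obtain ⟨v, hv, h⟩ := exists_eigenvector_of_mem_spectrum hz
  have := hA.re_inner_pos hv
  rw [h, inner_smul_right, inner_self_eq_norm_sq_to_K, mul_comm] at this
  have h2 : (((‖v‖ : ℝ) : ℂ) ^ 2 * z).re = ‖v‖ ^ 2 * z.re := by
    rw [← Complex.ofReal_pow, Complex.re_ofReal_mul]
  exact pos_of_mul_pos_right (h2 ▸ this) (by positivity)

theorem IsPosDef.isUnit_det_add (hA : IsPosDef A) {t : ℝ} (ht : 0 ≤ t) :
    IsUnit (A + (t : ℂ) • (1 : Matrix (Fin n) (Fin n) ℂ)).det := by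
  have h : -(t : ℂ) ∉ spectrum ℂ A := fun h => by
    have := hA.re_pos_of_mem_spectrum h
    simp at this
    linarith
  have := isUnit_det_sub_smul_one h
  rwa [neg_smul, sub_neg_eq_add] at this

theorem exists_isAdmissibleCircle_principalSqrt (h : ∀ z ∈ spectrum ℂ A, 0 < z.re) :
    ∃ c r, IsAdmissibleCircle principalSqrt A c r := by
  have hfin : (spectrum ℂ A).Finite := Matrix.finite_spectrum A
  -- For real `c > 0`, `|z - c| < c` holds exactly when `|z|² / (2 Re z) < c`; a finite spectrum
  -- allows one common `c`.
  obtain ⟨R, hR⟩ := (hfin.image fun z => ‖z‖ ^ 2 / (2 * z.re)).bddAbove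
  have hc0 : 0 < max R 0 + 1 := by positivity
  have hsub : spectrum ℂ A ⊆ Metric.ball ((max R 0 + 1 : ℝ) : ℂ) (max R 0 + 1) := fun z hz => by
    have h1 := hR (Set.mem_image_of_mem _ hz)
    have hz' := h z hz
    rw [div_le_iff₀ (by positivity)] at h1
    rw [Metric.mem_ball, dist_eq_norm]
    refine lt_of_pow_lt_pow_left₀ 2 hc0.le ?_
    have h3 : ‖z‖ ^ 2 < (max R 0 + 1) * (2 * z.re) :=
      h1.trans_lt (mul_lt_mul_of_pos_right (by linarith [le_max_left R 0]) (by positivity))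
    rw [Complex.sq_norm, Complex.normSq_apply] at h3 ⊢
    simp only [Complex.sub_re, Complex.sub_im, Complex.ofReal_re, Complex.ofReal_im]
    nlinarith
  -- A slightly smaller radius keeps the closed disc away from the branch point `0`.
  obtain ⟨r, ⟨hr0, hr⟩, hrs⟩ := exists_pos_lt_subset_ball hc0 hfin.isClosed hsub
  refine ⟨((max R 0 + 1 : ℝ) : ℂ), r, hr0, hrs, ?_⟩
  have hd : DifferentiableOn ℂ principalSqrt Complex.slitPlane := fun z hz =>
    (differentiableAt_principalSqrt hz).differentiableWithinAt
  refine (hd.analyticOnNhd Complex.isOpen_slitPlane).mono fun z hz => Or.inl ?_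
  rw [Metric.mem_closedBall, dist_eq_norm] at hz
  have h1 := (Complex.abs_re_le_norm _).trans hz
  rw [Complex.sub_re, Complex.ofReal_re] at h1
  linarith [(abs_le.mp h1).1]

theorem matrixFun_eq_cauchyIntegral {f : ℂ → ℂ} (h : ∃ c r, IsAdmissibleCircle f A c r) :
    ∃ c r, IsAdmissibleCircle f A c r ∧ matrixFun f A = cauchyIntegral f A c r := by
  obtain ⟨c, r, h⟩ := h
  have h' : ∃ p : ℂ × ℝ, IsAdmissibleCircle f A p.1 p.2 := ⟨(c, r), h⟩
  exact ⟨_, _, h'.choose_spec, dif_pos h'⟩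

theorem IsPosDef.exists_matrixFun_principalSqrt (hA : IsPosDef A) :
    ∃ c r, IsAdmissibleCircle principalSqrt A c r ∧
      matrixFun principalSqrt A = cauchyIntegral principalSqrt A c r :=
  matrixFun_eq_cauchyIntegral
    (exists_isAdmissibleCircle_principalSqrt fun _ hz => hA.re_pos_of_mem_spectrum hz)

theorem IsPosDef.matrixFun_principalSqrt_mul_self (hA : IsPosDef A) :
    matrixFun principalSqrt A * matrixFun principalSqrt A = A := by
  obtain ⟨c, r, ⟨hr, hs, hf⟩, h⟩ := hA.exists_matrixFun_principalSqrt
  rw [h, ← cauchyIntegral_mul hr hs hf hf]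
  have h1 : (fun z => principalSqrt z * principalSqrt z) =
      fun z => (Polynomial.X : Polynomial ℂ).eval z := by
    funext z
    rw [← sq, principalSqrt_sq, Polynomial.eval_X]
  rw [h1, cauchyIntegral_polynomial hr hs, Polynomial.aeval_X]

theorem toEuclideanLin_add_smul_one (A : Matrix (Fin n) (Fin n) ℂ) (t : ℂ)
    (x : EuclideanSpace ℂ (Fin n)) :
    toEuclideanLin (A + t • 1) x = toEuclideanLin A x + t • x := by
  rw [map_add, map_smul, LinearMap.add_apply, LinearMap.smul_apply, toEuclideanLin_one_apply]

/-- The functional `B ↦ ⟪u, B x⟫`. -/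
def innerFunctional (u x : EuclideanSpace ℂ (Fin n)) : Matrix (Fin n) (Fin n) ℂ →ₗ[ℂ] ℂ where
  toFun B := inner ℂ u (toEuclideanLin B x)
  map_add' B C := by rw [map_add, LinearMap.add_apply, inner_add_right]
  map_smul' t B := by
    rw [map_smul, LinearMap.smul_apply, inner_smul_right, RingHom.id_apply, smul_eq_mul]

/-- With `y = (A + t)⁻¹ x`, the integrand has the sign of `Re ⟪A y + t y, A y⟫ = ‖A y‖² + t Re ⟪y, A
y⟫ > 0`. -/
theorem IsPosDef.matrixFun_principalSqrt (hA : IsPosDef A) :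
    IsPosDef (matrixFun principalSqrt A) := by
  intro x hx
  have hx0 : x ≠ 0 := fun h => by simp [h] at hx
  obtain ⟨c, r, hcr, h⟩ := hA.exists_matrixFun_principalSqrt
  have h1 := hcr.functional_principalSqrt (innerFunctional x x)
  have hint := hcr.integrableOn_functional (innerFunctional x x)
  rw [← h] at h1
  change inner ℂ x (toEuclideanLin (matrixFun principalSqrt A) x) = _ at h1
  rw [h1, ← Complex.ofReal_inv, Complex.re_ofReal_mul]
  refine mul_pos (inv_pos.mpr Real.pi_pos) ?_
  have hpos : ∀ t ∈ Set.Ioi (0 : ℝ),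
      0 < (((√t)⁻¹ : ℂ) * innerFunctional x x (A * (A + (t : ℂ) • 1)⁻¹)).re := fun t ht => by
    have ht' : (0 : ℝ) < t := ht
    rw [← Complex.ofReal_inv, Complex.re_ofReal_mul]
    refine mul_pos (inv_pos.mpr (Real.sqrt_pos.mpr ht')) ?_
    set y := toEuclideanLin (A + (t : ℂ) • 1)⁻¹ x with hy
    have hxy : toEuclideanLin (A + (t : ℂ) • 1) y = x := by
      rw [hy, ← toEuclideanLin_mul_apply, Matrix.mul_nonsing_inv _ (hA.isUnit_det_add ht'.le),
        toEuclideanLin_one_apply]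
    have hy0 : y ≠ 0 := fun h => hx0 (by rw [← hxy, h, map_zero])
    change 0 < (inner ℂ x (toEuclideanLin (A * (A + (t : ℂ) • 1)⁻¹) x)).re
    rw [toEuclideanLin_mul_apply, ← hy]
    conv_rhs => rw [← hxy]
    rw [toEuclideanLin_add_smul_one, inner_add_left, inner_smul_left, Complex.conj_ofReal,
      Complex.add_re, Complex.re_ofReal_mul]
    exact add_pos_of_nonneg_of_pos (inner_self_nonneg (𝕜 := ℂ))
      (mul_pos ht' (hA.re_inner_pos hy0))
  have hre : (∫ t in Set.Ioi (0 : ℝ),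
      ((√t)⁻¹ : ℂ) * innerFunctional x x (A * (A + (t : ℂ) • 1)⁻¹)).re =
      ∫ t in Set.Ioi (0 : ℝ),
        (((√t)⁻¹ : ℂ) * innerFunctional x x (A * (A + (t : ℂ) • 1)⁻¹)).re :=
    (integral_re hint).symm
  rw [hre, setIntegral_pos_iff_support_of_nonneg_ae]
  · refine lt_of_lt_of_le ?_ (measure_mono (s := Set.Ioi (0 : ℝ)) fun t ht => ?_)
    · simp
    · exact ⟨(hpos t ht).ne', ht⟩
  · filter_upwards [ae_restrict_mem measurableSet_Ioi] with t ht
    exact (hpos t ht).le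
  · exact hint.re

/-- `X` commutes with `X² = A`, hence with `S = f(A)`, so `(X - S)(X + S) = 0`; the sum `X + S` is
positive definite and therefore invertible. -/
theorem IsPosDef.eq_matrixFun_principalSqrt (hA : IsPosDef A) {X : Matrix (Fin n) (Fin n) ℂ}
    (hX : IsPosDef X) (h : X * X = A) : X = matrixFun principalSqrt A := by
  set S := matrixFun principalSqrt A with hS
  have hcomm : Commute S X := by
    obtain ⟨c, r, ⟨hr, hs, hf⟩, hc⟩ := hA.exists_matrixFun_principalSqrt
    rw [hS, hc]
    refine commute_cauchyIntegral hr hs hf ?_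
    rw [← h]
    exact (Commute.refl X).mul_left (Commute.refl X)
  have hpd : IsPosDef (X + S) := fun x hx => by
    rw [map_add, LinearMap.add_apply, inner_add_right, Complex.add_re]
    exact add_pos (hX x hx) (hA.matrixFun_principalSqrt x hx)
  have hu := hpd.isUnit_det_add le_rfl
  rw [Complex.ofReal_zero, zero_smul, add_zero] at hu
  have h0 : (X - S) * (X + S) = 0 := by
    rw [sub_mul, mul_add, mul_add, h, hA.matrixFun_principalSqrt_mul_self, hcomm.eq]
    abel
  have h1 := congrArg (· * (X + S)⁻¹) h0
  simp only [mul_assoc, Matrix.mul_nonsing_inv _ hu, mul_one, zero_mul] at h1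
  exact sub_eq_zero.mp h1

end

/-! ### The scalar integral, the decay of the shifted errors, and the error bound. -/

noncomputable section

open Matrix MeasureTheory

/-- Substitute `t = σ √(e^u - 1)`, so that `1 + (t/σ)² = e^u`. Then `e^u - 1 ≥ u` bounds the
integrand by that of a Gamma integral with parameter `3/4` and rate `(k - 1)/2`. -/
theorem setIntegral_sqrt_mul_inv_pow_le {σ : ℝ} (hσ : 0 < σ) {k : ℕ} (hk : 2 ≤ k) :
    IntegrableOn (fun t : ℝ => √t * ((√(1 + (t / σ) ^ 2)) ^ (k + 1))⁻¹) (Set.Ioi 0) ∧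
    ∫ t in Set.Ioi (0 : ℝ), √t * ((√(1 + (t / σ) ^ 2)) ^ (k + 1))⁻¹ ≤
      σ ^ (3 / 2 : ℝ) / 2 * ((1 / (((k : ℝ) - 1) / 2)) ^ (3 / 4 : ℝ) * Real.Gamma (3 / 4)) := by
  have hk' : (2 : ℝ) ≤ k := by exact_mod_cast hk
  set g : ℝ → ℝ := fun u => σ * √(Real.exp u - 1) with hg
  set g' : ℝ → ℝ := fun u => σ * (Real.exp u / (2 * √(Real.exp u - 1))) with hg'
  set F : ℝ → ℝ := fun t => √t * ((√(1 + (t / σ) ^ 2)) ^ (k + 1))⁻¹ with hF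
  have hpos : ∀ u ∈ Set.Ioi (0 : ℝ), 0 < Real.exp u - 1 := fun u hu => by
    have := Real.add_one_lt_exp (ne_of_gt hu)
    have hu' : (0 : ℝ) < u := hu
    linarith
  have himage : g '' Set.Ioi 0 = Set.Ioi 0 := by
    ext t
    constructor
    · rintro ⟨u, hu, rfl⟩
      exact mul_pos hσ (Real.sqrt_pos.mpr (hpos u hu))
    · intro ht
      have ht' : (0 : ℝ) < t := ht
      have h1 : 0 < (t / σ) ^ 2 := by positivity
      refine ⟨Real.log (1 + (t / σ) ^ 2), Real.log_pos (by linarith), ?_⟩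
      simp only [hg]
      rw [Real.exp_log (by positivity), add_sub_cancel_left, Real.sqrt_sq (by positivity)]
      field_simp
  have hderiv : ∀ u ∈ Set.Ioi (0 : ℝ), HasDerivWithinAt g (g' u) (Set.Ioi 0) u := fun u hu =>
    ((((Real.hasDerivAt_exp u).sub_const 1).sqrt (hpos u hu).ne').const_mul σ).hasDerivWithinAt
  have hinj : Set.InjOn g (Set.Ioi 0) := fun u hu v hv h => by
    have h1 := mul_left_cancel₀ hσ.ne' h
    rw [Real.sqrt_inj (hpos u hu).le (hpos v hv).le] at h1
    exact Real.exp_injective (by linarith)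
  have hval : ∀ u ∈ Set.Ioi (0 : ℝ), |g' u| • F (g u) = σ ^ (3 / 2 : ℝ) / 2 *
      ((Real.exp u - 1) ^ (-(1 / 4) : ℝ) * Real.exp (-((k - 1) / 2 * u))) := fun u hu => by
    have hv := hpos u hu
    have h1 : 1 + (g u / σ) ^ 2 = Real.exp u := by
      simp only [hg]
      rw [mul_div_cancel_left₀ _ hσ.ne', Real.sq_sqrt hv.le]
      ring
    have h2 : (√(Real.exp u)) ^ (k + 1) = Real.exp ((k + 1) / 2 * u) := by
      rw [Real.sqrt_eq_rpow, ← Real.exp_mul, ← Real.exp_nat_mul]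
      congr 1
      push_cast
      ring
    have h3 : 0 ≤ g' u := by simp only [hg']; positivity
    have h4 : √(g u) = σ ^ (1 / 2 : ℝ) * (Real.exp u - 1) ^ (1 / 4 : ℝ) := by
      simp only [hg]
      rw [Real.sqrt_mul hσ.le, Real.sqrt_eq_rpow, Real.sqrt_eq_rpow, Real.sqrt_eq_rpow,
        ← Real.rpow_mul hv.le]
      norm_num
    have h5 : σ ^ (3 / 2 : ℝ) = σ * σ ^ (1 / 2 : ℝ) := by
      rw [show (3 / 2 : ℝ) = 1 + 1 / 2 by norm_num, Real.rpow_add hσ, Real.rpow_one]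
    have h6 : (Real.exp u - 1) ^ (-(1 / 4) : ℝ) =
        (Real.exp u - 1) ^ (1 / 4 : ℝ) * (√(Real.exp u - 1))⁻¹ := by
      rw [Real.sqrt_eq_rpow, ← Real.rpow_neg hv.le, ← Real.rpow_add hv]
      norm_num
    have h7 : Real.exp (-((k - 1) / 2 * u)) = Real.exp u * (Real.exp ((k + 1) / 2 * u))⁻¹ := by
      rw [← Real.exp_neg, ← Real.exp_add]
      congr 1
      ring
    rw [abs_of_nonneg h3, smul_eq_mul]
    simp only [hF]
    rw [h1, h2, h4, h5, h6, h7]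
    simp only [hg']
    have := (Real.sqrt_pos.mpr hv).ne'
    field_simp
  set G : ℝ → ℝ := fun u => σ ^ (3 / 2 : ℝ) / 2 *
    (u ^ ((3 / 4 : ℝ) - 1) * Real.exp (-((k - 1) / 2 * u))) with hG
  have hGint : IntegrableOn G (Set.Ioi 0) := by
    have := integrableOn_rpow_mul_exp_neg_mul_rpow (s := (3 / 4 : ℝ) - 1) (p := 1)
      (b := (k - 1) / 2) (by norm_num) one_pos (by linarith)
    simp only [Real.rpow_one] at this
    refine (this.const_mul (σ ^ (3 / 2 : ℝ) / 2)).congr ?_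
    exact Filter.Eventually.of_forall fun u => by simp only [hG, neg_mul]
  have hle : ∀ u ∈ Set.Ioi (0 : ℝ), |g' u| • F (g u) ≤ G u := fun u hu => by
    rw [hval u hu]
    have hu' : (0 : ℝ) < u := hu
    have h1 : (Real.exp u - 1) ^ (-(1 / 4) : ℝ) ≤ u ^ ((3 / 4 : ℝ) - 1) := by
      rw [show (3 / 4 : ℝ) - 1 = -(1 / 4) by norm_num]
      exact Real.rpow_le_rpow_of_nonpos hu' (by linarith [Real.add_one_le_exp u]) (by norm_num)
    simp only [hG]
    gcongr
  have hFint : IntegrableOn (fun u => |g' u| • F (g u)) (Set.Ioi 0) := by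
    refine Integrable.mono' hGint ?_ ?_
    · refine ContinuousOn.aestronglyMeasurable (ContinuousOn.congr ?_ hval) measurableSet_Ioi
      refine continuousOn_const.mul (ContinuousOn.mul ?_ (by fun_prop))
      exact ContinuousOn.rpow_const (by fun_prop) fun u hu => Or.inl (hpos u hu).ne'
    · filter_upwards [ae_restrict_mem measurableSet_Ioi] with u hu
      refine (Real.norm_of_nonneg ?_).trans_le (hle u hu)
      simp only [hF, smul_eq_mul]
      positivity
  constructor
  · rw [← himage, integrableOn_image_iff_integrableOn_abs_deriv_smul measurableSet_Ioi hderiv hinj]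
    exact hFint
  · conv_lhs => rw [← himage]
    rw [integral_image_eq_integral_abs_deriv_smul measurableSet_Ioi hderiv hinj]
    refine (setIntegral_mono_on hFint hGint measurableSet_Ioi hle).trans_eq ?_
    simp only [hG]
    rw [integral_const_mul, Real.integral_rpow_mul_exp_neg_mul_Ioi (by norm_num) (by linarith)]

theorem one_div_rpow_le_two_mul_div {k : ℕ} (hk : 2 ≤ k) :
    1 / 2 * (1 / (((k : ℝ) - 1) / 2)) ^ (3 / 4 : ℝ) ≤
      1 / (2 : ℝ) ^ (1 / 4 : ℝ) * (2 * (k : ℝ) / (2 * (k : ℝ) - 3)) *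
        (k : ℝ) ^ (-(3 / 4) : ℝ) := by
  have hk' : (2 : ℝ) ≤ k := by exact_mod_cast hk
  have hk1 : 0 < (k : ℝ) - 1 := by linarith
  have h1 : (1 / (((k : ℝ) - 1) / 2)) = 2 * (k / (k - 1)) * (k : ℝ)⁻¹ := by
    field_simp
  have h2 : ((k : ℝ) / (k - 1)) ^ (3 / 4 : ℝ) ≤ 2 * (k : ℝ) / (2 * (k : ℝ) - 3) := by
    have h3 : 1 ≤ (k : ℝ) / (k - 1) := (one_le_div hk1).mpr (by linarith)
    calc ((k : ℝ) / (k - 1)) ^ (3 / 4 : ℝ) ≤ ((k : ℝ) / (k - 1)) ^ (1 : ℝ) :=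
          Real.rpow_le_rpow_of_exponent_le h3 (by norm_num)
      _ = k / (k - 1) := Real.rpow_one _
      -- Enlarging `k / (k - 1) = 2k / (2k - 2)` to the stated constant is pure slack; `k ≥ 2` keeps
      -- the denominator positive.
      _ ≤ 2 * (k : ℝ) / (2 * (k : ℝ) - 3) := by
          rw [div_le_div_iff₀ hk1 (by linarith)]
          nlinarith
  have h4 : 1 / 2 * (2 : ℝ) ^ (3 / 4 : ℝ) = 1 / (2 : ℝ) ^ (1 / 4 : ℝ) := by
    have : (2 : ℝ) ^ (3 / 4 : ℝ) * (2 : ℝ) ^ (1 / 4 : ℝ) = 2 := by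
      rw [← Real.rpow_add two_pos]; norm_num
    have h5 : (0 : ℝ) < (2 : ℝ) ^ (1 / 4 : ℝ) := by positivity
    field_simp
    linarith
  rw [h1, Real.mul_rpow (by positivity) (by positivity), Real.mul_rpow (by positivity)
    (by positivity), Real.inv_rpow (by positivity), ← Real.rpow_neg (by positivity), ← h4]
  calc 1 / 2 * ((2 : ℝ) ^ (3 / 4 : ℝ) * ((k : ℝ) / (k - 1)) ^ (3 / 4 : ℝ) *
        (k : ℝ) ^ (-(3 / 4) : ℝ))
      = 1 / 2 * (2 : ℝ) ^ (3 / 4 : ℝ) * ((k : ℝ) / (k - 1)) ^ (3 / 4 : ℝ) *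
        (k : ℝ) ^ (-(3 / 4) : ℝ) := by ring
    _ ≤ _ := by gcongr

variable {n : ℕ} {A : Matrix (Fin n) (Fin n) ℂ} {σ : ℝ}

/-- For `Re z ≥ 0` and `t ≥ 0`, `|z + t|² ≥ |z|² + t²`, and `t² ≥ (t/σ)² |z|²`. -/
theorem sqrt_mul_norm_le_norm_add {z : ℂ} (hσ : 0 < σ) (hre : 0 ≤ z.re) (hz : ‖z‖ ≤ σ) {t : ℝ}
    (ht : 0 ≤ t) : √(1 + (t / σ) ^ 2) * ‖z‖ ≤ ‖z + t‖ := by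
  refine le_of_sq_le_sq ?_ (norm_nonneg _)
  have h1 : ‖z + t‖ ^ 2 = ‖z‖ ^ 2 + 2 * t * z.re + t ^ 2 := by
    rw [Complex.sq_norm, Complex.sq_norm, Complex.normSq_apply, Complex.normSq_apply]
    simp
    ring
  have h2 : (t / σ) ^ 2 * ‖z‖ ^ 2 ≤ t ^ 2 := by
    rw [div_pow, div_mul_eq_mul_div, div_le_iff₀ (by positivity)]
    gcongr
  rw [mul_pow, Real.sq_sqrt (by positivity), h1]
  nlinarith [mul_nonneg ht hre]

/-- The determinant is the product of the eigenvalues, and the scalar estimate applies to each. Only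
a bound on the quadratic form is required, because that already bounds the eigenvalues. -/
theorem sqrt_pow_mul_norm_det_le (hσ : 0 < σ) (hA : IsPosDef A)
    (h : ∀ v : EuclideanSpace ℂ (Fin n), ‖inner ℂ v (toEuclideanLin A v)‖ ≤ σ * ‖v‖ ^ 2) {t : ℝ}
    (ht : 0 ≤ t) : √(1 + (t / σ) ^ 2) ^ n * ‖A.det‖ ≤
      ‖(A + (t : ℂ) • (1 : Matrix (Fin n) (Fin n) ℂ)).det‖ := by
  have hsplit := IsAlgClosed.splits A.charpoly
  have hdet : ∀ s : ℂ, ‖(A + s • (1 : Matrix (Fin n) (Fin n) ℂ)).det‖ =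
      (A.charpoly.roots.map fun z => ‖z + s‖).prod := fun s => by
    have h1 : A.charpoly.eval (-s) = (-(A + s • (1 : Matrix (Fin n) (Fin n) ℂ))).det := by
      rw [Matrix.eval_charpoly]
      congr 1
      rw [neg_add, add_comm, sub_eq_add_neg, ← neg_smul, Matrix.scalar_apply,
        Matrix.smul_one_eq_diagonal, add_comm]
    have h2 : ‖A.charpoly.eval (-s)‖ = ‖(A + s • (1 : Matrix (Fin n) (Fin n) ℂ)).det‖ := by
      rw [h1, Matrix.det_neg]; simp
    rw [← h2]
    conv_lhs => rw [hsplit.eq_prod_roots_of_monic (Matrix.charpoly_monic A)]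
    rw [Polynomial.eval_multiset_prod, ← coe_nnnorm, ← nnnormHom_apply, map_multiset_prod,
      NNReal.coe_multiset_prod, Multiset.map_map, Multiset.map_map, Multiset.map_map]
    congr 1
    refine Multiset.map_congr rfl fun z _ => ?_
    simp only [Function.comp_apply, Polynomial.eval_sub, Polynomial.eval_X, Polynomial.eval_C,
      nnnormHom_apply, coe_nnnorm]
    rw [← norm_neg]
    congr 1
    ring
  have hcard : A.charpoly.roots.card = n := by
    rw [← hsplit.natDegree_eq_card_roots, Matrix.charpoly_natDegree_eq_dim, Fintype.card_fin]
  have h0 : ‖A.det‖ = (A.charpoly.roots.map fun z => ‖z‖).prod := by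
    simpa using hdet 0
  rw [hdet, h0]
  rw [show √(1 + (t / σ) ^ 2) ^ n = √(1 + (t / σ) ^ 2) ^ A.charpoly.roots.card by rw [hcard],
    ← Multiset.prod_replicate, ← Multiset.map_const', ← Multiset.prod_map_mul]
  refine Multiset.prod_map_le_prod_map₀ _ _ (fun z _ => by positivity) fun z hz => ?_
  have hzs : z ∈ spectrum ℂ A :=
    Matrix.mem_spectrum_iff_isRoot_charpoly.mpr (Polynomial.isRoot_of_mem_roots hz)
  refine sqrt_mul_norm_le_norm_add hσ (hA.re_pos_of_mem_spectrum hzs).le ?_ ht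
  obtain ⟨v, hv, hvz⟩ := exists_eigenvector_of_mem_spectrum hzs
  have h3 := h v
  rw [hvz, inner_smul_right, inner_self_eq_norm_sq_to_K, norm_mul, norm_pow] at h3
  simp only [RCLike.norm_ofReal, abs_norm] at h3
  exact le_of_mul_le_mul_right h3 (by have := norm_pos_iff.mpr hv; positivity)

/-- The operator form of the scalar estimate: the cross term `2 t Re ⟪x, A x⟫` is nonnegative. -/
theorem sqrt_mul_norm_toEuclideanLin_le (hσ : 0 < σ) (hA : IsPosDef A)
    (h : ∀ v, ‖toEuclideanLin A v‖ ≤ σ * ‖v‖) {t : ℝ} (ht : 0 ≤ t)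
    (x : EuclideanSpace ℂ (Fin n)) :
    √(1 + (t / σ) ^ 2) * ‖toEuclideanLin A x‖ ≤ ‖toEuclideanLin (A + (t : ℂ) • 1) x‖ := by
  refine le_of_sq_le_sq ?_ (norm_nonneg _)
  have h1 : ‖toEuclideanLin (A + (t : ℂ) • 1) x‖ ^ 2 = ‖toEuclideanLin A x‖ ^ 2 +
      2 * (t * (inner ℂ x (toEuclideanLin A x)).re) + t ^ 2 * ‖x‖ ^ 2 := by
    have h2 : (inner ℂ (toEuclideanLin A x) ((t : ℂ) • x)).re =
        t * (inner ℂ x (toEuclideanLin A x)).re := by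
      rw [inner_smul_right, Complex.re_ofReal_mul, ← inner_conj_symm, Complex.conj_re]
    rw [toEuclideanLin_add_smul_one, norm_add_sq (𝕜 := ℂ), RCLike.re_eq_complex_re, h2,
      norm_smul, Complex.norm_real, mul_pow, Real.norm_eq_abs, sq_abs]
  have h2 : (t / σ) ^ 2 * ‖toEuclideanLin A x‖ ^ 2 ≤ t ^ 2 * ‖x‖ ^ 2 := by
    calc (t / σ) ^ 2 * ‖toEuclideanLin A x‖ ^ 2 ≤ (t / σ) ^ 2 * (σ * ‖x‖) ^ 2 := by
          gcongr; exact h x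
      _ = _ := by field_simp
  rw [mul_pow, Real.sq_sqrt (by positivity), h1]
  nlinarith [mul_nonneg ht (hA.re_inner_nonneg x)]

variable {M : Matrix (Fin n) (Fin n) ℂ} {b : EuclideanSpace ℂ (Fin n)} {k : ℕ}

theorem norm_arnoldiQ_apply (hb : b ≠ 0) (v : EuclideanSpace ℂ (Fin (arnoldiDim M b k))) :
    ‖toEuclideanLin (arnoldiQ M b k) v‖ = ‖v‖ := by
  have h : inner ℂ (toEuclideanLin (arnoldiQ M b k) v) (toEuclideanLin (arnoldiQ M b k) v) =
      inner ℂ v v := by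
    rw [← inner_toEuclideanLin_conjTranspose, ← toEuclideanLin_mul_apply,
      conjTranspose_arnoldiQ_mul_self hb, toEuclideanLin_one_apply]
  rw [inner_self_eq_norm_sq_to_K, inner_self_eq_norm_sq_to_K] at h
  have h' : ‖toEuclideanLin (arnoldiQ M b k) v‖ ^ 2 = ‖v‖ ^ 2 := by exact_mod_cast h
  exact (pow_left_inj₀ (norm_nonneg _) (norm_nonneg _) two_ne_zero).mp h'

theorem inner_arnoldiH (hb : b ≠ 0) (hk : 0 < k)
    (v : EuclideanSpace ℂ (Fin (arnoldiDim M b k))) :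
    inner ℂ v (toEuclideanLin (arnoldiH M b k) v) = inner ℂ (toEuclideanLin (arnoldiQ M b k) v)
      (toEuclideanLin M (toEuclideanLin (arnoldiQ M b k) v)) := by
  rw [arnoldiH_eq hb hk, toEuclideanLin_mul_apply, toEuclideanLin_mul_apply,
    inner_toEuclideanLin_conjTranspose]

theorem IsPosDef.arnoldiH (hM : IsPosDef M) (hb : b ≠ 0) (hk : 0 < k) :
    IsPosDef (arnoldiH M b k) := fun v hv => by
  rw [inner_arnoldiH hb hk]
  exact hM _ ((norm_arnoldiQ_apply hb v).trans hv)

theorem norm_inner_arnoldiH_le (hb : b ≠ 0) (hk : 0 < k)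
    (v : EuclideanSpace ℂ (Fin (arnoldiDim M b k))) :
    ‖inner ℂ v (toEuclideanLin (_root_.arnoldiH M b k) v)‖ ≤ sigmaMax M * ‖v‖ ^ 2 := by
  rw [inner_arnoldiH hb hk]
  refine (norm_inner_le_norm _ _).trans ?_
  calc _ ≤ ‖toEuclideanLin (arnoldiQ M b k) v‖ *
        (sigmaMax M * ‖toEuclideanLin (arnoldiQ M b k) v‖) := by
        gcongr; exact norm_toEuclideanLin_le_sigmaMax M _
    _ = _ := by rw [norm_arnoldiQ_apply hb]; ring

theorem IsPosDef.sigmaMax_pos (hM : IsPosDef M) (hb : b ≠ 0) : 0 < sigmaMax M := by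
  refine (sigmaMax_nonneg M).lt_of_ne fun h => ?_
  have h1 := norm_toEuclideanLin_le_sigmaMax M b
  rw [← h, zero_mul, norm_le_zero_iff] at h1
  have := hM.re_inner_pos hb
  rw [h1, inner_zero_right] at this
  exact lt_irrefl _ this

theorem sub_neg_smul_one (A : Matrix (Fin n) (Fin n) ℂ) (t : ℂ) :
    A - (-t) • (1 : Matrix (Fin n) (Fin n) ℂ) = A + t • 1 := by
  rw [neg_smul, sub_neg_eq_add]

/-- Equating the shift-independent residuals at `-t` and `0` gives `det (H + t) ξ_{-t} = det H · M
(M + t)⁻¹ ξ_0`. The determinant ratio supplies `k` factors of decay and `M (M + t)⁻¹` the last one.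
-/
theorem IsPosDef.sqrt_pow_mul_norm_fomError_le (hM : IsPosDef M) (hb : b ≠ 0) (hk : 0 < k)
    {t : ℝ} (ht : 0 ≤ t) :
    √(1 + (t / sigmaMax M) ^ 2) ^ (k + 1) * ‖fomError M b k (-(t : ℂ))‖ ≤
      ‖fomError M b k 0‖ := by
  have hσ := hM.sigmaMax_pos hb
  have hH := hM.arnoldiH (b := b) hb hk
  have hMt := hM.isUnit_det_add ht
  have hHt := hH.isUnit_det_add ht
  have hM0 := hM.isUnit_det_add le_rfl
  have hH0 := hH.isUnit_det_add le_rfl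
  have ht1 := det_smul_sub_fomError (z := -(t : ℂ)) hb hk (by rwa [sub_neg_smul_one])
    (by rwa [sub_neg_smul_one])
  have h01 := det_smul_sub_fomError (M := M) (b := b) (z := 0) hb hk
    (by simpa using hM0) (by simpa using hH0)
  rw [sub_neg_smul_one, sub_neg_smul_one] at ht1
  simp only [zero_smul, sub_zero] at h01
  rw [← h01] at ht1
  set a := √(1 + (t / sigmaMax M) ^ 2) with ha
  have ha1 : 1 ≤ a := Real.one_le_sqrt.mpr (by nlinarith [sq_nonneg (t / sigmaMax M)])
  set x := fomError M b k 0 with hx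
  set y := fomError M b k (-(t : ℂ)) with hy
  set d := (_root_.arnoldiH M b k).det with hd
  set dt := (_root_.arnoldiH M b k + (t : ℂ) • 1).det with hdt
  set w := toEuclideanLin (M + (t : ℂ) • 1)⁻¹ x with hw
  have hwx : toEuclideanLin (M + (t : ℂ) • 1) w = x := by
    rw [hw, ← toEuclideanLin_mul_apply, Matrix.mul_nonsing_inv _ hMt, toEuclideanLin_one_apply]
  have hcomm : toEuclideanLin M x = toEuclideanLin (M + (t : ℂ) • 1) (toEuclideanLin M w) := by
    conv_lhs => rw [← hwx]
    rw [toEuclideanLin_add_smul_one, toEuclideanLin_add_smul_one, map_add, map_smul]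
  have hyw : dt • y = d • toEuclideanLin M w := by
    have := congrArg (toEuclideanLin (M + (t : ℂ) • 1)⁻¹) ht1
    rw [hcomm, map_smul, map_smul, ← toEuclideanLin_mul_apply, ← toEuclideanLin_mul_apply,
      Matrix.nonsing_inv_mul _ hMt, toEuclideanLin_one_apply, toEuclideanLin_one_apply] at this
    exact this
  have hnw : a * ‖toEuclideanLin M w‖ ≤ ‖x‖ := by
    rw [← hwx]
    exact sqrt_mul_norm_toEuclideanLin_le hσ hM (norm_toEuclideanLin_le_sigmaMax M) ht w
  have hdet : a ^ arnoldiDim M b k * ‖d‖ ≤ ‖dt‖ :=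
    sqrt_pow_mul_norm_det_le hσ hH (norm_inner_arnoldiH_le hb hk) ht
  have hdt0 : 0 < ‖dt‖ := norm_pos_iff.mpr hHt.ne_zero
  have hnorm : ‖dt‖ * ‖y‖ = ‖d‖ * ‖toEuclideanLin M w‖ := by
    rw [← norm_smul, hyw, norm_smul]
  have ha0 : 0 < a := one_pos.trans_le ha1
  -- After an early stop `H` has fewer than `k` eigenvalues and the determinant bound is too weak,
  -- but then the residual vanishes and the shifted error is `0`.
  rcases (arnoldiDim_le (M := M) (b := b) k).lt_or_eq with hlt | heq
  · have hy0 : y = 0 := by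
      rw [← norm_eq_zero]
      have hr := arnoldiResidual_eq_zero (M := M) (b := b) hlt
      rw [← h01, smul_eq_zero] at hr
      have hd0 : d ≠ 0 := by
        have := hH0.ne_zero
        simpa using this
      have hMx := hr.resolve_left hd0
      rw [hMx, smul_zero, smul_eq_zero] at ht1
      have h2 := congrArg (toEuclideanLin (M + (t : ℂ) • 1)⁻¹)
        (ht1.resolve_left hHt.ne_zero)
      rw [← toEuclideanLin_mul_apply, Matrix.nonsing_inv_mul _ hMt, toEuclideanLin_one_apply,
        map_zero] at h2
      rw [h2, norm_zero]
    rw [hy0, norm_zero, mul_zero]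
    exact norm_nonneg _
  · rw [heq] at hdet
    refine le_of_mul_le_mul_left ?_ hdt0
    calc ‖dt‖ * (a ^ (k + 1) * ‖y‖) = a ^ (k + 1) * (‖dt‖ * ‖y‖) := by ring
      _ = (a ^ k * ‖d‖) * (a * ‖toEuclideanLin M w‖) := by rw [hnorm]; ring
      _ ≤ ‖dt‖ * ‖x‖ := by gcongr

/-- The functional `B ↦ ⟪u, Q B x⟫`. -/
def innerMulFunctional {m : ℕ} (u : EuclideanSpace ℂ (Fin n)) (Q : Matrix (Fin n) (Fin m) ℂ)
    (x : EuclideanSpace ℂ (Fin m)) : Matrix (Fin m) (Fin m) ℂ →ₗ[ℂ] ℂ where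
  toFun B := inner ℂ u (toEuclideanLin (Q * B) x)
  map_add' B C := by rw [Matrix.mul_add, map_add, LinearMap.add_apply, inner_add_right]
  map_smul' t B := by
    rw [Matrix.mul_smul, map_smul, LinearMap.smul_apply, inner_smul_right, RingHom.id_apply,
      smul_eq_mul]

theorem mul_inv_add_smul_one {t : ℂ} (h : IsUnit (A + t • (1 : Matrix (Fin n) (Fin n) ℂ)).det) :
    A * (A + t • 1)⁻¹ = 1 - t • (A + t • (1 : Matrix (Fin n) (Fin n) ℂ))⁻¹ := by
  have h1 := Matrix.mul_nonsing_inv _ h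
  rw [add_mul, Matrix.smul_mul, one_mul] at h1
  exact eq_sub_of_add_eq h1

theorem arnoldiApprox_zero (f : ℂ → ℂ) (M : Matrix (Fin n) (Fin n) ℂ) (k : ℕ) :
    arnoldiApprox f M 0 k = 0 :=
  map_zero _

theorem arnoldiApprox_eq (f : ℂ → ℂ) (hb : b ≠ 0) (hk : 0 < k) :
    arnoldiApprox f M b k = toEuclideanLin (arnoldiQ M b k * matrixFun f (arnoldiH M b k))
      (arnoldiStart M b k) := by
  rw [arnoldiApprox, toEuclideanLin_mul_apply _ (arnoldiQ M b k)ᴴ,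
    conjTranspose_arnoldiQ_apply hb hk]

/-- Subtract the integral representations for `M` and `H`. The identity terms cancel and `t^{-1/2} ·
t = √t`. -/
theorem IsPosDef.inner_error_eq (hM : IsPosDef M) (hb : b ≠ 0) (hk : 0 < k)
    (u : EuclideanSpace ℂ (Fin n)) :
    inner ℂ u (toEuclideanLin (matrixFun principalSqrt M) b - arnoldiApprox principalSqrt M b k) =
      (π : ℂ)⁻¹ * ∫ t in Set.Ioi (0 : ℝ),
        -((√t : ℂ) * inner ℂ u (fomError M b k (-(t : ℂ)))) := by
  have hH := hM.arnoldiH (b := b) hb hk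
  obtain ⟨c, r, hcr, h⟩ := hM.exists_matrixFun_principalSqrt
  obtain ⟨c', r', hcr', h'⟩ := hH.exists_matrixFun_principalSqrt
  have h1 := hcr.functional_principalSqrt (innerFunctional u b)
  have h2 := hcr'.functional_principalSqrt
    (innerMulFunctional u (arnoldiQ M b k) (arnoldiStart M b k))
  rw [← h] at h1
  rw [← h'] at h2
  rw [inner_sub_right, arnoldiApprox_eq _ hb hk]
  change innerFunctional u b (matrixFun principalSqrt M) -
    innerMulFunctional u (arnoldiQ M b k) (arnoldiStart M b k)
      (matrixFun principalSqrt (_root_.arnoldiH M b k)) = _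
  rw [h1, h2, ← mul_sub, ← integral_sub (hcr.integrableOn_functional _)
    (hcr'.integrableOn_functional _)]
  congr 1
  refine setIntegral_congr_fun measurableSet_Ioi fun t ht => ?_
  have ht' : (0 : ℝ) < t := ht
  have hs : (√t : ℂ) ≠ 0 := by exact_mod_cast (Real.sqrt_pos.mpr ht').ne'
  have hst : (√t : ℂ) * (√t : ℂ) = t := by exact_mod_cast Real.mul_self_sqrt ht'.le
  rw [mul_inv_add_smul_one (hM.isUnit_det_add ht'.le),
    mul_inv_add_smul_one (hH.isUnit_det_add ht'.le), map_sub, map_sub, map_smul, map_smul]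
  have e1 : innerFunctional u b 1 = inner ℂ u b := by
    change inner ℂ u (toEuclideanLin 1 b) = _
    rw [toEuclideanLin_one_apply]
  have e2 : innerMulFunctional u (arnoldiQ M b k) (arnoldiStart M b k) 1 = inner ℂ u b := by
    change inner ℂ u (toEuclideanLin (arnoldiQ M b k * 1) (arnoldiStart M b k)) = _
    rw [Matrix.mul_one, arnoldiQ_arnoldiStart hb hk]
  have e3 : inner ℂ u (fomError M b k (-(t : ℂ))) =
      innerFunctional u b (M + (t : ℂ) • 1)⁻¹ -
        innerMulFunctional u (arnoldiQ M b k) (arnoldiStart M b k)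
          (_root_.arnoldiH M b k + (t : ℂ) • 1)⁻¹ := by
    rw [fomError, inner_sub_right, sub_neg_smul_one, sub_neg_smul_one]
    rfl
  rw [e1, e2, e3, smul_eq_mul, smul_eq_mul, ← hst]
  field_simp
  ring

theorem IsPosDef.norm_error_le (hM : IsPosDef M) (hb : b ≠ 0) (hk : 2 ≤ k) :
    ‖toEuclideanLin (matrixFun principalSqrt M) b - arnoldiApprox principalSqrt M b k‖ ≤
      Real.Gamma (3 / 4) / ((2 : ℝ) ^ (1 / 4 : ℝ) * π) * (2 * (k : ℝ) / (2 * (k : ℝ) - 3)) *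
        sigmaMax M ^ (3 / 2 : ℝ) * (k : ℝ) ^ (-(3 / 4) : ℝ) * ‖fomError M b k 0‖ := by
  have hσ := hM.sigmaMax_pos hb
  obtain ⟨hint, hle⟩ := setIntegral_sqrt_mul_inv_pow_le hσ hk
  set e := toEuclideanLin (matrixFun principalSqrt M) b - arnoldiApprox principalSqrt M b k with he
  set ξ := ‖fomError M b k 0‖ with hξ
  have hmain : ‖e‖ * ‖e‖ ≤ π⁻¹ * ((∫ t in Set.Ioi (0 : ℝ),
      √t * ((√(1 + (t / sigmaMax M) ^ 2)) ^ (k + 1))⁻¹) * (‖e‖ * ξ)) := by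
    -- Testing against the error vector `e` itself turns the weak identity into a norm bound, once a
    -- factor `‖e‖` is cancelled.
    have h1 := congrArg norm (hM.inner_error_eq (b := b) hb (show 0 < k by omega) e)
    rw [← he, inner_self_eq_norm_sq_to_K, norm_pow, norm_mul, norm_inv, Complex.norm_real,
      Real.norm_of_nonneg Real.pi_pos.le] at h1
    simp only [RCLike.norm_ofReal, abs_norm] at h1
    rw [← sq, h1, ← integral_mul_const]
    refine mul_le_mul_of_nonneg_left ?_ (by positivity)
    refine norm_integral_le_of_norm_le (hint.mul_const _) ?_
    filter_upwards [ae_restrict_mem measurableSet_Ioi] with t ht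
    have ht' : (0 : ℝ) < t := ht
    have h2 := hM.sqrt_pow_mul_norm_fomError_le (b := b) hb (show 0 < k by omega) ht'.le
    set a := √(1 + (t / sigmaMax M) ^ 2) ^ (k + 1) with ha
    have ha0 : 0 < a := by positivity
    rw [norm_neg, norm_mul, Complex.norm_real, Real.norm_of_nonneg (Real.sqrt_nonneg t)]
    have h3 : ‖fomError M b k (-(t : ℂ))‖ ≤ a⁻¹ * ξ := by
      rw [inv_mul_eq_div, le_div_iff₀ ha0, mul_comm]
      exact h2
    calc √t * ‖inner ℂ e (fomError M b k (-(t : ℂ)))‖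
        ≤ √t * (‖e‖ * (a⁻¹ * ξ)) := by
          gcongr
          exact (norm_inner_le_norm _ _).trans (by gcongr)
      _ = _ := by ring
  have hΓ : 0 < Real.Gamma (3 / 4) := Real.Gamma_pos_of_pos (by norm_num)
  have hfinal : π⁻¹ * ((∫ t in Set.Ioi (0 : ℝ),
      √t * ((√(1 + (t / sigmaMax M) ^ 2)) ^ (k + 1))⁻¹) * ξ) ≤
      Real.Gamma (3 / 4) / ((2 : ℝ) ^ (1 / 4 : ℝ) * π) * (2 * (k : ℝ) / (2 * (k : ℝ) - 3)) *
        sigmaMax M ^ (3 / 2 : ℝ) * (k : ℝ) ^ (-(3 / 4) : ℝ) * ξ := by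
    have hc := one_div_rpow_le_two_mul_div hk
    have hs : 0 ≤ sigmaMax M ^ (3 / 2 : ℝ) * Real.Gamma (3 / 4) := by positivity
    have h5 := hle.trans_eq (show _ = (sigmaMax M ^ (3 / 2 : ℝ) * Real.Gamma (3 / 4)) *
      (1 / 2 * (1 / (((k : ℝ) - 1) / 2)) ^ (3 / 4 : ℝ)) by ring)
    have h6 := h5.trans (mul_le_mul_of_nonneg_left hc hs)
    have h7 : 0 ≤ π⁻¹ * ξ := by positivity
    calc _ = (∫ t in Set.Ioi (0 : ℝ),
          √t * ((√(1 + (t / sigmaMax M) ^ 2)) ^ (k + 1))⁻¹) * (π⁻¹ * ξ) := by ring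
      _ ≤ _ := mul_le_mul_of_nonneg_right h6 h7
      _ = _ := by field_simp
  rcases (norm_nonneg e).eq_or_lt with h0 | h0
  · rw [← h0]
    have : 0 < 2 * (k : ℝ) - 3 := by
      have : (2 : ℝ) ≤ k := by exact_mod_cast hk
      linarith
    positivity
  · refine le_trans (le_of_mul_le_mul_right ?_ h0) hfinal
    calc ‖e‖ * ‖e‖ ≤ _ := hmain
      _ = _ := by ring

end

theorem mainTheorem2 {n : ℕ} (M : Matrix (Fin n) (Fin n) ℂ) (hM : IsPosDef M)
    (b : EuclideanSpace ℂ (Fin n)) (k : ℕ) (hk : 2 ≤ k) :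
    (IsPosDef (matrixFun principalSqrt M) ∧
      matrixFun principalSqrt M * matrixFun principalSqrt M = M ∧
      ∀ X : Matrix (Fin n) (Fin n) ℂ, IsPosDef X → X * X = M → X = matrixFun principalSqrt M) ∧
    ‖Matrix.toEuclideanLin (matrixFun principalSqrt M) b - arnoldiApprox principalSqrt M b k‖ ≤
      Real.Gamma (3 / 4) / ((2 : ℝ) ^ (1 / 4 : ℝ) * π) * (2 * (k : ℝ) / (2 * (k : ℝ) - 3)) *
        sigmaMax M ^ (3 / 2 : ℝ) * (k : ℝ) ^ (-(3 / 4) : ℝ) * ‖fomError M b k 0‖ := by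
  refine ⟨⟨hM.matrixFun_principalSqrt, hM.matrixFun_principalSqrt_mul_self,
    fun X hX h => hM.eq_matrixFun_principalSqrt hX h⟩, ?_⟩
  rcases eq_or_ne b 0 with hb | hb
  · subst hb
    -- For `b = 0` the left side is zero, and nonnegativity of the right side is enough.
    rw [arnoldiApprox_zero, map_zero, sub_zero, norm_zero]
    have : 0 < 2 * (k : ℝ) - 3 := by
      have : (2 : ℝ) ≤ k := by exact_mod_cast hk
      linarith
    have hΓ : 0 < Real.Gamma (3 / 4) := Real.Gamma_pos_of_pos (by norm_num)
    have := sigmaMax_nonneg M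
    positivity
  · exact hM.norm_error_le hb hk
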